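/- Let $K$ be a commutative ring and let $t_0\ge 2$. Consider a $\langle t_0,t_0,t_0;t\rangle$-algorithm over $K$, i.e. matrices $U,V,W\in K^{t\times t_0^2}$ with $AB=W^{T}\big((U a)\odot(V b)\big)$ for all $A,B\in K^{t_0\times t_0}$, where $a,b$ are the vectors of entries of $A,B$ and $\odot$ is the entrywise product. Write $\psi,\phi,\varphi$ for the linear maps $U$, $V$, $W^{T}$. Suppose that it is given with an *algebra decomposition*: a selection $\ell_1$ of $p_1\le t$ of the $t$ products, selections $\ell_2,\dots,\ell_h$ ($h=t-p_1+1$) of single products, and linear maps with $$\ell_1\psi=\psi_{1,2}\psi_{1,1},\qquad \ell_1\phi=\phi_{1,2}\phi_{1,1},\qquad \varphi(z)=\varphi_0\big(\varphi_1(\ell_1 z),\ell_2z,\dots,\ell_hz\big),$$ where $\psi_{1,1}:K^{t_0\times t_0}\to K^{p_{1,1}}$, $\psi_{1,2}:K^{p_{1,1}}\to K^{p_1}$, $\phi_{1,1}:K^{t_0\times t_0}\to K^{p'_{1,1}}$, $\phi_{1,2}:K^{p'_{1,1}}\to K^{p_1}$, $\varphi_1:K^{p_1}\to K^{q_1}$,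 $p_{1,1},p'_{1,1},q_1\ge 2$ and $t-p_1>t_0^2$. Put $r=\max\{p_{1,1},p'_{1,1},q_1\}$ and assume $p_1>r$. Put $\psi_i=\ell_i\psi$, $\phi_i=\ell_i\phi$ for $2\le i\le h$. *Implementation.* Fix two straight-line programs. Each has finitely many registers of three kinds (for data of the left factor, the right factor and the product), does not overwrite its inputs, and consists of linear operations $x:=c_1u+c_2v$ on registers of one kind and of subroutine calls. The first computes $\varphi_1\big((\psi_{1,2}x)\odot(\phi_{1,2}y)\big)$, with exactly one call, a product, for each of the $p_1$ coordinates. The second, $\mathcal A$, computes $\varphi_0(c_1,\dots,c_h)$ with $c_1=\xi_1(\psi_{1,1}x,\phi_{1,1}y)$ and $c_i=\xi_2(\psi_ix,\phi_iy)$ for $i\ge 2$, with exactly one call for each $i$, correctly for arbitrary results of the calls. *Algorithm AC* maps vectors $S$, $T$ of lengths $p_{1,1}^x$, $p_{1,1}'^{\,x}$ to a vector of length $q_1^x$. For $x=0$ it returns the product; for $x\ge1$ it runs the first program on the $p_{1,1}$ (resp. $p'_{1,1}$) consecutive blocks of $S$ (resp. $T$), with linear operations acting entrywise on blocks, and with recursive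 calls of AC as products. *Algorithm BC* takes sequences $S$, $T$ of $p_{1,1}^x$, resp. $p_{1,1}'^{\,x}$, matrices of size $t_0^q\times t_0^q$ and returns a sequence of $q_1^x$ such matrices. For $q=0$ it calls AC$(S,T)$. For $q\ge1$ it divides all matrices into $t_0\times t_0$ blocks and runs $\mathcal A$ simultaneously on all members of the sequences, with linear operations acting entrywise, and with one recursive call of BC on the concatenated sequences as each $c_i$ (so $c_1$ is computed from sequences of lengths $p_{1,1}^{x+1}$, $p_{1,1}'^{\,x+1}$). With input $A,B\in R^{n\times n}$, $n=t_0^q$, it is called with $S=(A)$, $T=(B)$. *IO complexity.* On a machine with an unbounded slow memory and a fast memory of $M$ words, the word-level instructions of the algorithm are executed in their order, each with its operands and its result in fast memory. Initially all data are in slow memory, and in the end the output has to be in slow memory. The IO complexity is the least number of words transferred between the two memories. **Theorem.** 1. For every such algorithm the IO complexity of BC with input $A,B\in R^{n\times n}$ is $O\!\left(n^{\log_{t_0}t}\,M^{\,1-\log_r p_1}\right)$ as $n\to\infty$, with a constant that does not depend on $M$. Precisely, there are constants $C,\kappa>0$, depending only on the base-case algorithm, its decomposition and the two programs, such that for every integer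 $M\ge3$ and every $n=t_0^q$ with $n\ge M^{\kappa}$ the IO complexity of BC on $n\times n$ inputs with fast memory $M$ is at most $C\,n^{\log_{t_0}t}M^{1-\log_rp_1}$. 2. The exponent of $M$ can be smaller than the exponent in Ballard's lower bound $\Omega\big((n/\sqrt M)^{\log_{t_0}t}M\big)$ for recursive Strassen-like algorithms: over every commutative ring $K$ there is a decomposed algorithm as above (with $p_1>r$) such that $1-\log_rp_1<1-\tfrac12\log_{t_0}t$. -/

import Mathlib

/-- The three kinds of data of a bilinear algorithm: left factor, right factor, product. -/
inductive Side where
  | A | B | C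
  deriving DecidableEq

/-! ### Register programs

A register program describes a straight-line algorithm with subroutine calls.  On side `s` it has
the interface registers `I s` (the inputs for `s = A, B`, the outputs for `s = C`) and `w s` work
registers.  A step is either one linear operation `dst := c₁ • u + c₂ • v` inside one side, or the
`i`-th call, which reads `ar i A` registers of side `A` and `ar i B` registers of side `B`, and
overwrites `ar i C` registers of side `C`. -/

/-- A register of side `s`: an interface register or a work register. -/
abbrev Reg (I : Side → Type) (w : Side → ℕ) (s : Side) : Type := I s ⊕ Fin (w s)

inductive Step (K : Type*) (I : Side → Type) (w : Side → ℕ) (ι : Type) where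
  | lin (s : Side) (c₁ c₂ : K) (dst u v : Reg I w s)
  | call (i : ι)

structure Scheme (K : Type*) (I : Side → Type) (ι : Type) (ar : ι → Side → ℕ) where
  /-- number of work registers on each side -/
  w : Side → ℕ
  /-- the registers on which a call operates -/
  arg : (i : ι) → (s : Side) → Fin (ar i s) → Reg I w s
  /-- the program -/
  steps : List (Step K I w ι)
  arg_injective : ∀ i, Function.Injective (arg i Side.C)
  /-- the inputs are read-only -/
  readonly : ∀ s c₁ c₂ dst u v, Step.lin s c₁ c₂ dst u v ∈ steps → s ≠ Side.C → dst.isRight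

namespace Scheme

variable {K : Type*} [CommRing K] {I : Side → Type} [∀ s, DecidableEq (I s)] {ι : Type}
  {ar : ι → Side → ℕ}

/-- The effect of one step on the contents `σ` of the registers, where `z i` is the vector that the
`i`-th call returns. -/
noncomputable def applyStep (P : Scheme K I ι ar) (z : (i : ι) → Fin (ar i Side.C) → K)
    (σ : (s : Side) → Reg I P.w s → K) : Step K I P.w ι → (s : Side) → Reg I P.w s → K
  | .lin s c₁ c₂ dst u v =>
      Function.update σ s (Function.update (σ s) dst (c₁ * σ s u + c₂ * σ s v))
  | .call i => Function.update σ Side.C (Function.extend (P.arg i Side.C) (z i) (σ Side.C))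

/-- The contents of the registers after a list of steps. -/
noncomputable def run (P : Scheme K I ι ar) (z : (i : ι) → Fin (ar i Side.C) → K)
    (l : List (Step K I P.w ι)) (σ : (s : Side) → Reg I P.w s → K) :
    (s : Side) → Reg I P.w s → K :=
  l.foldl (P.applyStep z) σ

/-- The program computes `dec (ξ_i (encA_i x, encB_i y))_i` from the inputs `x`, `y`, by one call
`ξ_i` for each `i`: every call occurs exactly once; when it occurs, its argument registers hold the
vectors `encA_i x` and `encB_i y`; and in the end the output registers hold `dec z`, where `z` are
the results of the calls.  This has to hold for every initial contents of the other registers. -/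
def Computes [∀ s, Fintype (I s)] (P : Scheme K I ι ar)
    (encA : (i : ι) → Matrix (Fin (ar i Side.A)) (I Side.A) K)
    (encB : (i : ι) → Matrix (Fin (ar i Side.B)) (I Side.B) K)
    (dec : ((i : ι) → Fin (ar i Side.C) → K) → I Side.C → K) : Prop :=
  (∀ i, ∃ pre post, P.steps = pre ++ Step.call i :: post ∧
    Step.call i ∉ pre ∧ Step.call i ∉ post ∧
    ∀ z σ,
      (∀ k, P.run z pre σ Side.A (P.arg i Side.A k)
        = (encA i).mulVec (fun e => σ Side.A (Sum.inl e)) k) ∧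
      (∀ k, P.run z pre σ Side.B (P.arg i Side.B k)
        = (encB i).mulVec (fun e => σ Side.B (Sum.inl e)) k)) ∧
  ∀ z σ e, P.run z P.steps σ Side.C (Sum.inl e) = dec z e

end Scheme

/-- Number of registers that a call of the base-case algorithm uses: call `none` is the block call
(a vector of length `p s` on side `s`), the calls `some k` are single products. -/
def callArity (p : Side → ℕ) {m : ℕ} : Option (Fin m) → Side → ℕ
  | none, s => p s
  | some _, _ => 1

/-! ### Decomposed square base-case algorithms -/

/-- A `⟨t₀,t₀,t₀;t⟩`-algorithm over `K` with encoding matrices `U`, `V` and decoding matrix `W`,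
together with an algebra decomposition, and with straight-line programs that implement it.
`p A`, `p B`, `p C` are the lengths `p_{1,1}`, `p'_{1,1}`, `q_1`. -/
structure Decomposition (K : Type*) [CommRing K] where
  t₀ : ℕ
  t : ℕ
  p₁ : ℕ
  p : Side → ℕ
  two_le_t₀ : 2 ≤ t₀
  p₁_le : p₁ ≤ t
  two_le_p : ∀ s, 2 ≤ p s
  gap : t₀ ^ 2 < t - p₁
  U : Matrix (Fin t) (Fin t₀ × Fin t₀) K
  V : Matrix (Fin t) (Fin t₀ × Fin t₀) K
  W : Matrix (Fin t) (Fin t₀ × Fin t₀) K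
  /-- `W^T (U a ⊙ V b)` is the matrix product -/
  isMatMul : ∀ (a b : Matrix (Fin t₀) (Fin t₀) K) (i j : Fin t₀),
    W.transpose.mulVec (U.mulVec (fun e => a e.1 e.2) * V.mulVec (fun e => b e.1 e.2)) (i, j)
      = (a * b) i j
  /-- the interception map `ℓ_1` selects `p₁` of the `t` products -/
  sel₁ : Fin p₁ ↪o Fin t
  /-- each of the other interception maps selects one product -/
  sel : Fin (t - p₁) → Fin t
  /-- `ℓ_1 ψ = ψ_{1,2} ψ_{1,1}` -/
  psi₁₁ : Matrix (Fin (p Side.A)) (Fin t₀ × Fin t₀) K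
  psi₁₂ : Matrix (Fin p₁) (Fin (p Side.A)) K
  psi_eq : U.submatrix sel₁ id = psi₁₂ * psi₁₁
  /-- `ℓ_1 ϕ = ϕ_{1,2} ϕ_{1,1}` -/
  phi₁₁ : Matrix (Fin (p Side.B)) (Fin t₀ × Fin t₀) K
  phi₁₂ : Matrix (Fin p₁) (Fin (p Side.B)) K
  phi_eq : V.submatrix sel₁ id = phi₁₂ * phi₁₁
  /-- `φ = φ_0 (φ_1 ℓ_1, ℓ_2, …, ℓ_h)` -/
  dec₁ : Matrix (Fin (p Side.C)) (Fin p₁) K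
  dec₀ : Matrix (Fin t₀ × Fin t₀) (Fin (p Side.C) ⊕ Fin (t - p₁)) K
  dec_eq : ∀ z : Fin t → K, W.transpose.mulVec z
    = dec₀.mulVec (Sum.elim (dec₁.mulVec (z ∘ sel₁)) (z ∘ sel))
  /-- a program for `φ_1 (ψ_{1,2}(x) ⊙ ϕ_{1,2}(y))`, with one call per product -/
  ac : Scheme K (fun s => Fin (p s)) (Fin p₁) (fun _ _ => 1)
  ac_computes : ac.Computes (fun i => Matrix.of fun _ => psi₁₂ i) (fun i => Matrix.of fun _ => phi₁₂ i)
    (fun z => dec₁.mulVec fun i => z i 0)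
  /-- a program for `φ_0 (c_1, …, c_h)`, where `c_1 = ξ_1(ψ_{1,1}(x), ϕ_{1,1}(y))` is the block call
  and the other `c_i = ξ_2(ψ_i(x), ϕ_i(y))` are the single products -/
  alg : Scheme K (fun _ => Fin t₀ × Fin t₀) (Option (Fin (t - p₁))) (callArity p)
  alg_computes : alg.Computes
    (fun i => match i with
      | none => psi₁₁
      | some k => Matrix.of fun _ => U (sel k))
    (fun i => match i with
      | none => phi₁₁
      | some k => Matrix.of fun _ => V (sel k))
    (fun z => dec₀.mulVec (Sum.elim (z none) (fun k => z (some k) (0 : Fin 1))))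

/-! ### Word-level programs -/

/-- Addresses of memory cells: stack frame, side, register, and the position (component, row,
column) inside the register.  Frame `0` holds the input and the output. -/
abbrev Addr : Type := ℕ × Side × ℕ × ℕ × ℕ × ℕ

/-- Machine instructions on single words: `dst := c₁ • u + c₂ • v` and `dst := u * v`. -/
inductive Instr (K : Type*) where
  | lin (c₁ c₂ : K) (dst u v : Addr)
  | mul (dst u v : Addr)

namespace Instr

variable {K : Type*}

def dst : Instr K → Addr
  | lin _ _ d _ _ => d
  | mul d _ _ => d

def src₁ : Instr K → Addr
  | lin _ _ _ u _ => u
  | mul _ u _ => u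

def src₂ : Instr K → Addr
  | lin _ _ _ _ v => v
  | mul _ _ v => v

end Instr

namespace Decomposition

variable {K : Type*} [CommRing K]

/-- Algorithm AC.  `v s` lists the addresses of a vector of length `p s ^ x`; the result of
`AC (v A, v B)` is written to `v C`, and frame `d` is used for the work registers.  A linear
operation on registers acts on vectors of length `p s ^ (x - 1)` entry by entry. -/
def acProg (D : Decomposition K) : (x d : ℕ) → (v : Side → ℕ → Addr) → List (Instr K)
  | 0, _, v => [.mul (v .C 0) (v .A 0) (v .B 0)]
  | x + 1, d, v =>
    let cell : (s : Side) → Reg (fun s => Fin (D.p s)) D.ac.w s → ℕ → Addr := fun s r z =>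
      match r with
      | .inl e => v s (e.val * D.p s ^ x + z)
      | .inr k => (d, s, k.val, z, 0, 0)
    D.ac.steps.flatMap fun st =>
      match st with
      | .lin s c₁ c₂ dst u u' =>
          (List.range (D.p s ^ x)).map fun z => .lin c₁ c₂ (cell s dst z) (cell s u z) (cell s u' z)
      | .call i => acProg D x (d + 1) fun s => cell s (D.ac.arg i s 0)

/-- Algorithm BC.  `v s` lists the addresses of a sequence of `p s ^ x` matrices of size
`t₀ ^ h × t₀ ^ h` (component, row, column); the result of `BC (v A, v B)` is written to `v C`, and
frame `d` is used for the work registers.  The block call concatenates, over all components, the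
vectors of length `p s` to which it is applied. -/
def bcProg (D : Decomposition K) :
    (h x d : ℕ) → (v : Side → ℕ → ℕ → ℕ → Addr) → List (Instr K)
  | 0, x, d, v => D.acProg x d fun s z => v s z 0 0
  | h + 1, x, d, v =>
    let cell : (s : Side) → Reg (fun _ => Fin D.t₀ × Fin D.t₀) D.alg.w s → ℕ → ℕ → ℕ → Addr :=
      fun s r z i j =>
        match r with
        | .inl e => v s z (e.1.val * D.t₀ ^ h + i) (e.2.val * D.t₀ ^ h + j)
        | .inr k => (d, s, k.val, z, i, j)
    D.alg.steps.flatMap fun st =>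
      match st with
      | .lin s c₁ c₂ dst u u' =>
          (List.range (D.p s ^ x)).flatMap fun z => (List.range (D.t₀ ^ h)).flatMap fun i =>
            (List.range (D.t₀ ^ h)).map fun j =>
              .lin c₁ c₂ (cell s dst z i j) (cell s u z i j) (cell s u' z i j)
      | .call none => bcProg D h (x + 1) (d + 1) fun s z =>
          cell s (D.alg.arg none s
            ⟨z % D.p s, Nat.mod_lt _ (lt_of_lt_of_le Nat.zero_lt_two (D.two_le_p s))⟩) (z / D.p s)
      | .call (some k) => bcProg D h x (d + 1) fun s => cell s (D.alg.arg (some k) s (0 : Fin 1))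

/-- Algorithm BC on a pair of `t₀ ^ q × t₀ ^ q` matrices. -/
def bc (D : Decomposition K) (q : ℕ) : List (Instr K) :=
  D.bcProg q 0 1 fun s z i j => (0, s, 0, z, i, j)

/-- The cells in which the product of two `n × n` matrices is returned. -/
def outputs (n : ℕ) : Set Addr := {a | ∃ i < n, ∃ j < n, a = (0, Side.C, 0, 0, i, j)}

/-- `r = max {p_{1,1}, p'_{1,1}, q_1}` -/
def r (D : Decomposition K) : ℕ := max (D.p Side.A) (max (D.p Side.B) (D.p Side.C))

end Decomposition

/-! ### The two-level memory machine -/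

/-- `Exec M prog fast slow c slow'`: on a machine with a fast memory of `M` words and an unbounded
slow memory, the program can be executed, instruction by instruction in its order, with `c` words
transferred.  `fast` is the set of cells that have a copy in fast memory, and `slow` is the set of
cells whose current value is in slow memory (`slow'` at the end).  Instructions operate on fast
memory only. -/
inductive Exec {K : Type*} (M : ℕ) :
    List (Instr K) → Finset Addr → Set Addr → ℕ → Set Addr → Prop
  | done (fast : Finset Addr) (slow : Set Addr) : Exec M [] fast slow 0 slow
  | load (a : Addr) {prog : List (Instr K)} {fast : Finset Addr} {slow : Set Addr} {c : ℕ}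
      {slow' : Set Addr} (ha : a ∈ slow) (hM : (insert a fast).card ≤ M)
      (h : Exec M prog (insert a fast) slow c slow') : Exec M prog fast slow (c + 1) slow'
  | store (a : Addr) {prog : List (Instr K)} {fast : Finset Addr} {slow : Set Addr} {c : ℕ}
      {slow' : Set Addr} (ha : a ∈ fast)
      (h : Exec M prog fast (insert a slow) c slow') : Exec M prog fast slow (c + 1) slow'
  | evict (a : Addr) {prog : List (Instr K)} {fast : Finset Addr} {slow : Set Addr} {c : ℕ}
      {slow' : Set Addr} (h : Exec M prog (fast.erase a) slow c slow') : Exec M prog fast slow c slow'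
  | instr (ins : Instr K) {prog : List (Instr K)} {fast : Finset Addr} {slow : Set Addr} {c : ℕ}
      {slow' : Set Addr} (h₁ : ins.src₁ ∈ fast) (h₂ : ins.src₂ ∈ fast)
      (hM : (insert ins.dst fast).card ≤ M)
      (h : Exec M prog (insert ins.dst fast) (slow \ {ins.dst}) c slow') :
      Exec M (ins :: prog) fast slow c slow'

/-- The IO complexity of a program: the least number of words that are transferred between slow and
fast memory, if all data are in slow memory at the beginning and the output has to be in slow memory
at the end (`⊤` if the program cannot be executed). -/
noncomputable def ioComplexity {K : Type*} (M : ℕ) (prog : List (Instr K)) (out : Set Addr) : ℕ∞ :=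
  sInf {k : ℕ∞ | ∃ (c : ℕ) (slow' : Set Addr),
    Exec M prog ∅ Set.univ c slow' ∧ out ⊆ slow' ∧ k = c}

/-- The IO complexity of Algorithm BC on `t₀ ^ q × t₀ ^ q` matrices, with fast memory of size `M`. -/
noncomputable def Decomposition.bcCost {K : Type*} [CommRing K] (D : Decomposition K) (M q : ℕ) : ℕ∞ :=
  ioComplexity M (D.bc q) (Decomposition.outputs (D.t₀ ^ q))

/-! ### Executing programs on the two-level memory machine -/

/-! Upper bound. `RunsIn` records executions that start with empty fast memory and all values in
slow memory, and end with all values in slow memory, so costs add under concatenation. An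
instruction costs at most 6 transfers, and a program confined to at most `M` cells costs at most
twice their number (`RunsIn.of_within`), however many instructions it has.

AC at depth `x` makes exponentially many calls, but its interface and its stack of work frames
occupy only O(r^x) cells (`card_acWork`). Once these fit into fast memory, the cost is O(r^x)
instead of O(p₁^x). Let x₀ be the threshold, where r^x₀ is of order M. Above it, the recurrence
c(x+1) ≤ O(r^x) + p₁ c(x) gives r^x₀ p₁^(x-x₀) = p₁^x (r/p₁)^x₀. Since r^`memExp` = r/p₁, the last
factor is O(M^`memExp`), so that AC costs O(p₁^x M^`memExp` + r^x) for all x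
(`exists_acProg_bound`).

For BC, c(h+1,x) ≤ O(r^x t₀^(2h)) + c(h,x+1) + (t-p₁) c(h,x). Without the linear operations, both
p₁^x t^h and r^x (t-p₁+r)^h solve this with equality; the gap t-p₁ > t₀² lets the second absorb the
linear operations (`exists_bcProg_bound`). At x = 0 the bound is t^q M^`memExp` + (t-p₁+r)^q up to a
constant. As r < p₁, the second term has a smaller exponent in n and is dominated as soon as n is at
least a fixed power of M (`exists_bcCost_bound`).

Example. Split 4×4 matrices into 2×2 blocks. Of the eight block products, seven are done by
Strassen's algorithm and one classically, as the block call: t = 49 + 8 = 57, p₁ = 8, r = 4. The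
exponent comparison reduces to 57 < 8² (`BlockStrassen.decomposition`, `exponent_lt`). The required
register programs come from a generic compiler (`Scheme.sequential_computes`). -/

namespace Instr

variable {K : Type*}

/-- All operands and the result of the instruction lie in `F`. -/
def Within (F : Finset Addr) (ins : Instr K) : Prop :=
  ins.src₁ ∈ F ∧ ins.src₂ ∈ F ∧ ins.dst ∈ F

end Instr

namespace Exec

variable {K : Type*} {M : ℕ}

theorem of_empty_fast {prog : List (Instr K)} {slow slow' : Set Addr} {c : ℕ}
    (h : Exec M prog ∅ slow c slow') (fast : Finset Addr) : Exec M prog fast slow c slow' := by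
  classical
  induction fast using Finset.induction_on with
  | empty => exact h
  | insert a s ha ih =>
    refine Exec.evict a ?_
    rwa [Finset.erase_insert ha]

/-- Eviction is free, so whatever the first program leaves in fast memory can be dropped before the
second begins. -/
theorem append {p₁ p₂ : List (Instr K)} {fast : Finset Addr} {slow s₁ s₂ : Set Addr} {c₁ c₂ : ℕ}
    (h₁ : Exec M p₁ fast slow c₁ s₁) (h₂ : Exec M p₂ ∅ s₁ c₂ s₂) :
    Exec M (p₁ ++ p₂) fast slow (c₁ + c₂) s₂ := by
  induction h₁ with
  | done fast slow => simpa using h₂.of_empty_fast fast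
  | load a ha hM _ ih => rw [Nat.add_right_comm]; exact .load a ha hM (ih h₂)
  | store a ha _ ih => rw [Nat.add_right_comm]; exact .store a ha (ih h₂)
  | evict a _ ih => exact .evict a (ih h₂)
  | instr ins ha hb hM _ ih => exact .instr ins ha hb hM (ih h₂)

theorem store_all {fast : Finset Addr} (G : Finset Addr) (hG : G ⊆ fast) (slow : Set Addr) :
    Exec M ([] : List (Instr K)) fast slow G.card (slow ∪ G) := by
  classical
  induction G using Finset.induction_on generalizing slow with
  | empty => simpa using Exec.done fast slow
  | insert a s ha ih =>
    rw [Finset.card_insert_of_notMem ha]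
    have h := ih (fun x hx => hG (Finset.mem_insert_of_mem hx)) (insert a slow)
    have e : slow ∪ ↑(insert a s) = insert a slow ∪ (s : Set Addr) := by
      ext x; simp only [Finset.coe_insert, Set.mem_union, Set.mem_insert_iff]; tauto
    rw [e]
    exact .store a (hG (Finset.mem_insert_self a s)) h

theorem load_all {prog : List (Instr K)} {slow' : Set Addr} {c : ℕ} (G : Finset Addr)
    (hG : G.card ≤ M) (h : Exec M prog G Set.univ c slow') :
    Exec M prog ∅ Set.univ (c + G.card) slow' := by
  classical
  induction G using Finset.induction_on generalizing c with
  | empty => simpa using h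
  | insert a s ha ih =>
    rw [Finset.card_insert_of_notMem ha] at hG ⊢
    rw [← Nat.add_assoc, Nat.add_right_comm]
    refine ih (by omega) (.load a (Set.mem_univ a) ?_ h)
    rwa [Finset.card_insert_of_notMem ha]

/-- With all of `F` resident, no transfers are needed while the program runs. Only cells of `F` can
become stale in slow memory, so storing `F` once at the end restores every value. -/
theorem of_within {F : Finset Addr} (hF : F.card ≤ M) (prog : List (Instr K))
    (h : ∀ ins ∈ prog, ins.Within F) (slow : Set Addr) (hs : (F : Set Addr)ᶜ ⊆ slow) :
    Exec M prog F slow F.card Set.univ := by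
  classical
  induction prog generalizing slow with
  | nil =>
    have e : slow ∪ (F : Set Addr) = Set.univ := by
      ext x
      simp only [Set.mem_union, Set.mem_univ, iff_true]
      by_cases hx : x ∈ (F : Set Addr)
      · exact Or.inr hx
      · exact Or.inl (hs hx)
    rw [← e]
    exact store_all F subset_rfl slow
  | cons ins prog ih =>
    obtain ⟨h₁, h₂, h₃⟩ := h ins List.mem_cons_self
    refine .instr ins h₁ h₂ ?_ ?_
    · rwa [Finset.insert_eq_of_mem h₃]
    · have e : insert ins.dst F = F := Finset.insert_eq_of_mem h₃
      convert ih (fun i hi => h i (List.mem_cons_of_mem _ hi)) (slow \ {ins.dst}) ?_ using 1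
      exact fun x hx => ⟨hs hx, fun hx' => hx (hx' ▸ h₃)⟩

end Exec

/-- The program can be executed with at most `c` words transferred, from empty fast memory and
with all values in slow memory both at the beginning and at the end. -/
def RunsIn {K : Type*} (M : ℕ) (prog : List (Instr K)) (c : ℝ) : Prop :=
  ∃ c' : ℕ, (c' : ℝ) ≤ c ∧ Exec M prog ∅ Set.univ c' Set.univ

namespace RunsIn

variable {K : Type*} {M : ℕ}

theorem mono {prog : List (Instr K)} {c c' : ℝ} (h : RunsIn M prog c) (hc : c ≤ c') :
    RunsIn M prog c' := by
  obtain ⟨k, hk, h⟩ := h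
  exact ⟨k, hk.trans hc, h⟩

theorem nil : RunsIn M ([] : List (Instr K)) 0 := ⟨0, by simp, .done _ _⟩

theorem append {p₁ p₂ : List (Instr K)} {c₁ c₂ : ℝ} (h₁ : RunsIn M p₁ c₁) (h₂ : RunsIn M p₂ c₂) :
    RunsIn M (p₁ ++ p₂) (c₁ + c₂) := by
  obtain ⟨k₁, hk₁, h₁⟩ := h₁
  obtain ⟨k₂, hk₂, h₂⟩ := h₂
  exact ⟨k₁ + k₂, by push_cast; linarith, h₁.append h₂⟩

theorem of_within {F : Finset Addr} (hF : F.card ≤ M) {prog : List (Instr K)}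
    (h : ∀ ins ∈ prog, ins.Within F) : RunsIn M prog (2 * F.card) :=
  ⟨F.card + F.card, by push_cast; linarith,
    Exec.load_all F hF (Exec.of_within hF prog h _ (Set.subset_univ _))⟩

theorem singleton (hM : 3 ≤ M) (ins : Instr K) : RunsIn M [ins] 6 := by
  classical
  have hc : ({ins.src₁, ins.src₂, ins.dst} : Finset Addr).card ≤ 3 := Finset.card_le_three
  refine (of_within (F := {ins.src₁, ins.src₂, ins.dst}) (hc.trans hM) ?_).mono ?_
  · intro i hi
    rw [List.mem_singleton] at hi
    subst hi
    simp [Instr.Within]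
  · have : (({ins.src₁, ins.src₂, ins.dst} : Finset Addr).card : ℝ) ≤ 3 := by exact_mod_cast hc
    linarith

theorem of_length (hM : 3 ≤ M) (prog : List (Instr K)) : RunsIn M prog (6 * prog.length) := by
  induction prog with
  | nil => simpa using nil
  | cons ins prog ih =>
    refine ((singleton hM ins).append ih).mono ?_
    simp only [List.length_cons]; push_cast; linarith

theorem flatMap {α : Type*} {l : List α} {f : α → List (Instr K)} {g : α → ℝ}
    (h : ∀ a ∈ l, RunsIn M (f a) (g a)) : RunsIn M (l.flatMap f) (l.map g).sum := by
  induction l with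
  | nil => simpa using nil
  | cons a l ih =>
    rw [List.flatMap_cons, List.map_cons, List.sum_cons]
    exact (h a List.mem_cons_self).append (ih fun b hb => h b (List.mem_cons_of_mem _ hb))

/-- Any execution bounds the infimum by a finite number, which rules out `⊤`. -/
theorem ioComplexity_eq {prog : List (Instr K)} {c : ℝ} (h : RunsIn M prog c) (out : Set Addr) :
    ∃ k : ℕ, ioComplexity M prog out = k ∧ (k : ℝ) ≤ c := by
  obtain ⟨k, hk, h⟩ := h
  have hle : ioComplexity M prog out ≤ k := sInf_le ⟨k, Set.univ, h, Set.subset_univ _, rfl⟩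
  obtain ⟨m, hm⟩ := ENat.ne_top_iff_exists.mp (ne_top_of_le_ne_top (ENat.natCast_ne_top k) hle)
  refine ⟨m, hm.symm, le_trans ?_ hk⟩
  rw [← hm] at hle
  exact_mod_cast hle

end RunsIn

/-! ### Counting the calls of a register program -/

namespace Scheme

variable {K : Type*} [CommRing K] {I : Side → Type} [∀ s, DecidableEq (I s)] {ι : Type}
  {ar : ι → Side → ℕ}

theorem Computes.count_call [∀ s, Fintype (I s)]
    {P : Scheme K I ι ar} {encA encB dec} (h : P.Computes encA encB dec)
    [DecidableEq (Step K I P.w ι)] (i : ι) : P.steps.count (.call i) = 1 := by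
  obtain ⟨pre, post, e, h₁, h₂, -⟩ := h.1 i
  rw [e, List.count_append, List.count_cons_self, List.count_eq_zero_of_not_mem h₁,
    List.count_eq_zero_of_not_mem h₂]

/-- Stated with multiplicities of the calls so that induction on an arbitrary list is possible;
`Computes.count_call` then makes them all 1. -/
theorem sum_map_steps_le {K : Type*} {I : Side → Type} [Fintype ι] {w : Side → ℕ}
    [DecidableEq (Step K I w ι)]
    (l : List (Step K I w ι)) (g : Step K I w ι → ℝ) (L : ℝ) (hL : 0 ≤ L)
    (hg : ∀ s c₁ c₂ dst u v, g (.lin s c₁ c₂ dst u v) ≤ L) :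
    (l.map g).sum ≤ l.length * L + ∑ i, l.count (.call i) * g (.call i) := by
  classical
  induction l with
  | nil => simp
  | cons st l ih =>
    rw [List.map_cons, List.sum_cons, List.length_cons]
    push_cast
    cases st with
    | lin s c₁ c₂ dst u v =>
      have := hg s c₁ c₂ dst u v
      have e : ∀ i, (Step.lin s c₁ c₂ dst u v :: l).count (.call i) = l.count (.call i) :=
        fun i => List.count_cons_of_ne (by simp)
      simp only [e]
      linarith
    | call j =>
      have e : ∀ i, (((Step.call j :: l).count (.call i) : ℕ) : ℝ) * g (.call i)
          = l.count (.call i) * g (.call i) + if j = i then g (.call i) else 0 := by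
        intro i
        rw [List.count_cons]
        by_cases hij : j = i
        · subst hij; simp; ring
        · simp [hij]
      simp only [e, Finset.sum_add_distrib, Finset.sum_ite_eq, Finset.mem_univ, if_true]
      linarith

theorem Computes.sum_map_le [Fintype ι] [∀ s, Fintype (I s)] {P : Scheme K I ι ar}
    {encA encB dec} (h : P.Computes encA encB dec) (g : Step K I P.w ι → ℝ) (L : ℝ) (hL : 0 ≤ L)
    (hg : ∀ s c₁ c₂ dst u v, g (.lin s c₁ c₂ dst u v) ≤ L) :
    (P.steps.map g).sum ≤ P.steps.length * L + ∑ i, g (.call i) := by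
  classical
  refine (sum_map_steps_le P.steps g L hL hg).trans_eq ?_
  simp [h.count_call]

end Scheme

namespace Decomposition

variable {K : Type*} [CommRing K] (D : Decomposition K)

theorem p_le_r (s : Side) : D.p s ≤ D.r := by
  cases s <;> simp [Decomposition.r]

theorem two_le_r : 2 ≤ D.r := (D.two_le_p .A).trans (D.p_le_r .A)

theorem p_pow_le (s : Side) (x : ℕ) : D.p s ^ x ≤ D.r ^ x := Nat.pow_le_pow_left (D.p_le_r s) x

/-! ### The cost of Algorithm AC -/

/-- The bound on the recursive calls is uniform in the frame and the addresses, so only sizes enter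
the recurrence. -/
theorem acProg_succ_runsIn {M : ℕ} (hM : 3 ≤ M) {x : ℕ} {c : ℝ}
    (h : ∀ d v, RunsIn M (D.acProg x d v) c) (d : ℕ) (v : Side → ℕ → Addr) :
    RunsIn M (D.acProg (x + 1) d v) (D.ac.steps.length * (6 * (D.r : ℝ) ^ x) + D.p₁ * c) := by
  rw [acProg]
  refine (RunsIn.flatMap (g := fun st => match st with
    | .lin .. => 6 * (D.r : ℝ) ^ x
    | .call _ => c) ?_).mono
      ((D.ac_computes.sum_map_le _ (6 * (D.r : ℝ) ^ x) (by positivity) ?_).trans_eq ?_)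
  · intro st _
    cases st with
    | lin s c₁ c₂ dst u u' =>
      refine (RunsIn.of_length hM _).mono ?_
      have := D.p_pow_le s x
      simp only [List.length_map, List.length_range]
      gcongr
      exact_mod_cast this
    | call i => exact h _ _
  · intros; exact le_rfl
  · simp

/-! ### The working set of AC, and AC inside fast memory -/

/-- Bound for the number of cells that one frame of AC uses. -/
def frameSize : ℕ := D.ac.w .A + D.ac.w .B + D.ac.w .C

/-- The cells of the interface of a call of AC. -/
def acInterface (x : ℕ) (v : Side → ℕ → Addr) : Finset Addr :=
  (Finset.range (D.p .A ^ x)).image (v .A) ∪ (Finset.range (D.p .B ^ x)).image (v .B) ∪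
    (Finset.range (D.p .C ^ x)).image (v .C)

/-- The cells of the work registers of side `s` in one frame of AC. -/
def acFrame (x d : ℕ) (s : Side) : Finset Addr :=
  (Finset.range (D.ac.w s) ×ˢ Finset.range (D.p s ^ x)).image fun kz => (d, s, kz.1, kz.2, 0, 0)

/-- The cells of the work registers of AC, including those of the recursive calls. -/
def acWork : ℕ → ℕ → Finset Addr
  | 0, _ => ∅
  | x + 1, d => D.acFrame x d .A ∪ D.acFrame x d .B ∪ D.acFrame x d .C ∪ acWork x (d + 1)

theorem mem_acInterface {x : ℕ} {v : Side → ℕ → Addr} {s : Side} {z : ℕ} (hz : z < D.p s ^ x) :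
    v s z ∈ D.acInterface x v := by
  have := Finset.mem_image_of_mem (v s) (Finset.mem_range.2 hz)
  cases s <;> simp only [acInterface, Finset.mem_union] <;> tauto

theorem mem_acFrame {x d : ℕ} {s : Side} {k z : ℕ} (hk : k < D.ac.w s) (hz : z < D.p s ^ x) :
    ((d, s, k, z, 0, 0) : Addr) ∈ D.acWork (x + 1) d := by
  have : ((d, s, k, z, 0, 0) : Addr) ∈ D.acFrame x d s :=
    Finset.mem_image.2 ⟨(k, z), by simp [hk, hz], rfl⟩
  cases s <;> simp only [acWork, Finset.mem_union] <;> tauto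

theorem card_acFrame (x d : ℕ) (s : Side) : (D.acFrame x d s).card ≤ D.ac.w s * D.r ^ x := by
  refine Finset.card_image_le.trans ?_
  rw [Finset.card_product, Finset.card_range, Finset.card_range]
  exact Nat.mul_le_mul_left _ (D.p_pow_le s x)

/-- Calls at the same depth reuse the same frame, so there is one frame per level. The frame sizes
form a geometric series of ratio r ≥ 2, whose sum over the exponents below x is at most r^x. -/
theorem card_acWork (x d : ℕ) : (D.acWork x d).card ≤ D.frameSize * D.r ^ x := by
  induction x generalizing d with
  | zero => simp [acWork]
  | succ x ih =>
    have h₁ := D.card_acFrame x d .A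
    have h₂ := D.card_acFrame x d .B
    have h₃ := D.card_acFrame x d .C
    have h₄ := ih (d + 1)
    have : D.frameSize * D.r ^ x * 2 ≤ D.frameSize * D.r ^ (x + 1) := by
      rw [pow_succ, ← mul_assoc]; exact Nat.mul_le_mul_left _ D.two_le_r
    rw [acWork]
    refine (Finset.card_union_le _ _).trans ?_
    have h₅ := Finset.card_union_le (D.acFrame x d .A ∪ D.acFrame x d .B) (D.acFrame x d .C)
    have h₆ := Finset.card_union_le (D.acFrame x d .A) (D.acFrame x d .B)
    have e : D.frameSize * D.r ^ x = D.ac.w .A * D.r ^ x + D.ac.w .B * D.r ^ x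
      + D.ac.w .C * D.r ^ x := by rw [frameSize]; ring
    omega

theorem card_acInterface (x : ℕ) (v : Side → ℕ → Addr) :
    (D.acInterface x v).card ≤ 3 * D.r ^ x := by
  have h (s : Side) : ((Finset.range (D.p s ^ x)).image (v s)).card ≤ D.r ^ x :=
    Finset.card_image_le.trans (by simpa using D.p_pow_le s x)
  have h₁ := h .A
  have h₂ := h .B
  have h₃ := h .C
  rw [acInterface]
  refine (Finset.card_union_le _ _).trans ?_
  have h₄ := Finset.card_union_le ((Finset.range (D.p .A ^ x)).image (v .A))
    ((Finset.range (D.p .B ^ x)).image (v .B))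
  omega

theorem acProg_within (x d : ℕ) (v : Side → ℕ → Addr) (F : Finset Addr)
    (hv : ∀ s, ∀ z < D.p s ^ x, v s z ∈ F) (hw : D.acWork x d ⊆ F) :
    ∀ ins ∈ D.acProg x d v, ins.Within F := by
  induction x generalizing d v with
  | zero =>
    intro ins hins
    rw [acProg, List.mem_singleton] at hins
    subst hins
    exact ⟨hv .A 0 (by simp), hv .B 0 (by simp), hv .C 0 (by simp)⟩
  | succ x ih =>
    intro ins hins
    rw [acProg, List.mem_flatMap] at hins
    have hcell : ∀ (s : Side) (r : Reg (fun s => Fin (D.p s)) D.ac.w s), ∀ z < D.p s ^ x,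
        (match r with
          | .inl e => v s (e.val * D.p s ^ x + z)
          | .inr k => ((d, s, k.val, z, 0, 0) : Addr)) ∈ F := by
      intro s r z hz
      cases r with
      | inl e =>
        refine hv s _ ?_
        calc e.val * D.p s ^ x + z < e.val * D.p s ^ x + D.p s ^ x := by omega
          _ = (e.val + 1) * D.p s ^ x := by ring
          _ ≤ D.p s * D.p s ^ x := Nat.mul_le_mul_right _ e.isLt
          _ = D.p s ^ (x + 1) := by ring
      | inr k => exact hw (D.mem_acFrame k.isLt hz)
    obtain ⟨st, -, hins⟩ := hins
    cases st with
    | lin s c₁ c₂ dst u u' =>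
      obtain ⟨z, hz, rfl⟩ := List.mem_map.1 hins
      rw [List.mem_range] at hz
      exact ⟨hcell s u z hz, hcell s u' z hz, hcell s dst z hz⟩
    | call i =>
      refine ih (d + 1) _ (fun s z hz => hcell s _ z hz) ?_ ins hins
      exact Finset.subset_union_right.trans hw

/-- The number of cells used by AC, in units of `r ^ x`. -/
def acSpace : ℕ := 3 + D.frameSize

/-- This is the source of the saving: the cost is governed by the space of AC, not by its number of
instructions. -/
theorem acProg_runsIn_of_fits {M x : ℕ} (h : D.acSpace * D.r ^ x ≤ M) (d : ℕ)
    (v : Side → ℕ → Addr) : RunsIn M (D.acProg x d v) (2 * (D.acSpace * (D.r : ℝ) ^ x)) := by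
  classical
  have hc : (D.acInterface x v ∪ D.acWork x d).card ≤ D.acSpace * D.r ^ x := by
    refine (Finset.card_union_le _ _).trans ?_
    have h₁ := D.card_acInterface x v
    have h₂ := D.card_acWork x d
    rw [acSpace, add_mul]
    omega
  refine (RunsIn.of_within (hc.trans h) (D.acProg_within x d v _ ?_ ?_)).mono ?_
  · exact fun s z hz => Finset.mem_union_left _ (D.mem_acInterface hz)
  · exact Finset.subset_union_right
  · gcongr
    exact_mod_cast hc

/-! ### From the recurrence to the exponent of the memory size -/

theorem acProg_add_runsIn {M : ℕ} (hM : 3 ≤ M) (hr : D.r < D.p₁) {x : ℕ} {k : ℝ}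
    (h : ∀ d v, RunsIn M (D.acProg x d v) (k * (D.r : ℝ) ^ x)) (j : ℕ) :
    ∀ d v, RunsIn M (D.acProg (x + j) d v)
      ((k + 6 * D.ac.steps.length) * (D.r : ℝ) ^ x * (D.p₁ : ℝ) ^ j
        - 6 * D.ac.steps.length * (D.r : ℝ) ^ (x + j)) := by
  induction j with
  | zero => exact fun d v => (h d v).mono (le_of_eq (by simp; ring))
  | succ j ih =>
    intro d v
    refine (D.acProg_succ_runsIn hM ih d v).mono ?_
    have hr' : (D.r : ℝ) + 1 ≤ D.p₁ := by exact_mod_cast hr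
    -- The subtracted term of the bound is multiplied by p₁ ≥ r + 1 in the recurrence: r of these
    -- copies form the new subtracted term, and one pays for the linear operations.
    have : 0 ≤ 6 * (D.ac.steps.length : ℝ) * (D.r : ℝ) ^ (x + j) * (D.p₁ - (D.r + 1)) :=
      mul_nonneg (by positivity) (by linarith)
    rw [← add_assoc x j 1, pow_succ (D.r : ℝ) (x + j), pow_succ (D.p₁ : ℝ) j]
    linarith

/-- The exponent of the memory size. -/
noncomputable def memExp : ℝ := 1 - Real.logb D.r D.p₁

theorem memExp_neg (hr : D.r < D.p₁) : D.memExp < 0 := by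
  have h2 : (1 : ℝ) < D.r := by exact_mod_cast D.two_le_r
  have hr' : (D.r : ℝ) < D.p₁ := by exact_mod_cast hr
  have := Real.logb_lt_logb h2 (by linarith) hr'
  rw [Real.logb_self_eq_one h2] at this
  rw [memExp]; linarith

theorem r_rpow_memExp (hr : D.r < D.p₁) : (D.r : ℝ) ^ D.memExp = D.r / D.p₁ := by
  have h2 : (1 : ℝ) < D.r := by exact_mod_cast D.two_le_r
  have hr' : (D.r : ℝ) < D.p₁ := by exact_mod_cast hr
  rw [memExp, Real.rpow_sub (by linarith), Real.rpow_one,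
    Real.rpow_logb (by linarith) (by linarith) (by linarith)]

/-- The alternative `x₀ = 0` covers memories too small for the space bound even at depth 0; AC is
then a single product. -/
theorem exists_threshold (M : ℕ) :
    ∃ x₀, (x₀ = 0 ∨ D.acSpace * D.r ^ x₀ ≤ M) ∧ M ≤ D.acSpace * D.r ^ (x₀ + 1) := by
  classical
  have hs : 1 ≤ D.acSpace := by rw [acSpace]; omega
  have hex : ∃ x, M ≤ D.acSpace * D.r ^ (x + 1) := by
    refine ⟨M, ?_⟩
    calc M ≤ D.r ^ M := (Nat.lt_pow_self D.two_le_r).le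
      _ ≤ D.r ^ (M + 1) := Nat.pow_le_pow_right (by have := D.two_le_r; omega) (by omega)
      _ ≤ _ := Nat.le_mul_of_pos_left _ hs
  refine ⟨Nat.find hex, ?_, Nat.find_spec hex⟩
  rcases Nat.eq_zero_or_pos (Nat.find hex) with h | h
  · exact Or.inl h
  · right
    have := Nat.find_min hex (m := Nat.find hex - 1) (by omega)
    rw [Nat.sub_add_cancel h] at this
    omega

/-- Raise the upper bound on M to the negative power `memExp`, which reverses it and turns r^x₀ into
(r/p₁)^x₀. -/
theorem pow_threshold_le (hr : D.r < D.p₁) {M x₀ : ℕ} (hM : 1 ≤ M)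
    (h : M ≤ D.acSpace * D.r ^ (x₀ + 1)) :
    ((D.r : ℝ) / D.p₁) ^ x₀ ≤ ((D.acSpace * D.r : ℝ) ^ (-D.memExp)) * (M : ℝ) ^ D.memExp := by
  have hr0 : (0 : ℝ) < D.r := by have := D.two_le_r; positivity
  have hs : (0 : ℝ) < D.acSpace := by rw [acSpace]; positivity
  have hM' : (0 : ℝ) < M := by exact_mod_cast hM
  have hle : (M : ℝ) ≤ D.acSpace * D.r * (D.r : ℝ) ^ x₀ := by
    have : (M : ℝ) ≤ D.acSpace * (D.r : ℝ) ^ (x₀ + 1) := by exact_mod_cast h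
    rw [pow_succ] at this; linarith
  have := Real.rpow_le_rpow_of_nonpos hM' hle (D.memExp_neg hr).le
  rw [Real.mul_rpow (by positivity) (by positivity), ← Real.rpow_pow_comm hr0.le,
    D.r_rpow_memExp hr] at this
  rw [Real.rpow_neg (by positivity), inv_mul_eq_div, le_div_iff₀ (by positivity)]
  linarith

theorem exists_acProg_bound (hr : D.r < D.p₁) : ∃ C : ℝ, 0 < C ∧ ∀ M, 3 ≤ M → ∀ x d v,
    RunsIn M (D.acProg x d v) (C * ((D.p₁ : ℝ) ^ x * (M : ℝ) ^ D.memExp + (D.r : ℝ) ^ x)) := by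
  have hr0 : (0 : ℝ) < D.r := by have := D.two_le_r; positivity
  have hs : (3 : ℝ) ≤ D.acSpace := by
    rw [acSpace]; push_cast; linarith [D.frameSize.cast_nonneg (α := ℝ)]
  have hp0 : (0 : ℝ) < D.p₁ := by
    have : (D.r : ℝ) < D.p₁ := by exact_mod_cast hr
    linarith
  set a : ℝ := 2 * D.acSpace with ha
  set b : ℝ := a + 6 * D.ac.steps.length with hb
  have hb0 : 0 < b := by positivity
  set g : ℝ := (D.acSpace * D.r : ℝ) ^ (-D.memExp) with hg
  have hg0 : 0 < g := by positivity
  refine ⟨a + b * g, by positivity, fun M hM x d v => ?_⟩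
  have hM0 : (0 : ℝ) < M := by positivity
  obtain ⟨x₀, h₀, h₁⟩ := D.exists_threshold M
  have hbase : ∀ d v, RunsIn M (D.acProg x₀ d v) (a * (D.r : ℝ) ^ x₀) := by
    rcases h₀ with rfl | h₀
    · intro d v
      refine (RunsIn.of_length hM _).mono ?_
      -- One product costs 6, which is at most `a` because `acSpace` is at least 3.
      simp [acProg]; linarith
    · exact fun d v => (D.acProg_runsIn_of_fits h₀ d v).mono (le_of_eq (by rw [ha]; ring))
  have hmem : 0 < (M : ℝ) ^ D.memExp := by positivity
  rcases le_total x₀ x with hx | hx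
  · obtain ⟨j, rfl⟩ := Nat.exists_eq_add_of_le hx
    refine (D.acProg_add_runsIn hM hr hbase j d v).mono ?_
    have ht := D.pow_threshold_le hr (by omega) h₁
    rw [← hg, div_pow, div_le_iff₀ (by positivity)] at ht
    have h2 : b * (D.r : ℝ) ^ x₀ * (D.p₁ : ℝ) ^ j
        ≤ b * g * ((D.p₁ : ℝ) ^ (x₀ + j) * (M : ℝ) ^ D.memExp) := by
      calc b * (D.r : ℝ) ^ x₀ * (D.p₁ : ℝ) ^ j
          ≤ b * (g * (M : ℝ) ^ D.memExp * (D.p₁ : ℝ) ^ x₀) * (D.p₁ : ℝ) ^ j := by gcongr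
        _ = _ := by rw [pow_add]; ring
    have h3 : 0 ≤ 6 * (D.ac.steps.length : ℝ) * (D.r : ℝ) ^ (x₀ + j) := by positivity
    have h4 : 0 ≤ a * ((D.p₁ : ℝ) ^ (x₀ + j) * (M : ℝ) ^ D.memExp) := by positivity
    have h5 : 0 ≤ (a + b * g) * (D.r : ℝ) ^ (x₀ + j) := by positivity
    linarith
  · rcases h₀ with rfl | h₀
    · obtain rfl : x = 0 := by omega
      refine (hbase d v).mono ?_
      have : 0 ≤ b * g := by positivity
      have h3 : 0 ≤ (a + b * g) * ((D.p₁ : ℝ) ^ 0 * (M : ℝ) ^ D.memExp) := by positivity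
      simp only [pow_zero] at *
      linarith
    · have hfit : D.acSpace * D.r ^ x ≤ M := le_trans
        (Nat.mul_le_mul_left _ (Nat.pow_le_pow_right (by have := D.two_le_r; omega) hx)) h₀
      refine (D.acProg_runsIn_of_fits hfit d v).mono ?_
      have h2 : 0 ≤ (a + b * g) * ((D.p₁ : ℝ) ^ x * (M : ℝ) ^ D.memExp) := by positivity
      have h3 : 0 ≤ b * g * (D.r : ℝ) ^ x := by positivity
      rw [ha] at *
      linarith

/-! ### The cost of Algorithm BC -/

theorem bcProg_succ_runsIn {M : ℕ} (hM : 3 ≤ M) {h x : ℕ} {c₁ c₂ : ℝ}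
    (h₁ : ∀ d v, RunsIn M (D.bcProg h (x + 1) d v) c₁)
    (h₂ : ∀ d v, RunsIn M (D.bcProg h x d v) c₂) (d : ℕ) (v : Side → ℕ → ℕ → ℕ → Addr) :
    RunsIn M (D.bcProg (h + 1) x d v)
      (6 * D.alg.steps.length * ((D.r : ℝ) ^ x * ((D.t₀ : ℝ) ^ 2) ^ h)
        + (c₁ + ((D.t - D.p₁ : ℕ) : ℝ) * c₂)) := by
  rw [bcProg]
  refine (RunsIn.flatMap (g := fun st => match st with
    | .lin .. => 6 * ((D.r : ℝ) ^ x * ((D.t₀ : ℝ) ^ 2) ^ h)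
    | .call none => c₁
    | .call (some _) => c₂) ?_).mono
      ((D.alg_computes.sum_map_le _ (6 * ((D.r : ℝ) ^ x * ((D.t₀ : ℝ) ^ 2) ^ h))
        (by positivity) ?_).trans_eq ?_)
  · intro st _
    cases st with
    | lin s a₁ a₂ dst u u' =>
      refine (RunsIn.of_length hM _).mono ?_
      have := D.p_pow_le s x
      simp only [List.length_flatMap, List.length_map, List.length_range, List.map_const',
        List.sum_replicate, smul_eq_mul]
      push_cast
      have e : ((D.t₀ : ℝ) ^ 2) ^ h = (D.t₀ : ℝ) ^ h * (D.t₀ : ℝ) ^ h := by ring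
      have h' : (D.p s : ℝ) ^ x ≤ (D.r : ℝ) ^ x := by exact_mod_cast this
      rw [e]
      gcongr
    | call i =>
      cases i with
      | none => exact h₁ _ _
      | some k => exact h₂ _ _
  · intros; exact le_rfl
  · simp [Fintype.sum_option]; ring

theorem exists_bcProg_bound (hr : D.r < D.p₁) : ∃ C : ℝ, 0 < C ∧ ∀ M, 3 ≤ M → ∀ h x d v,
    RunsIn M (D.bcProg h x d v) (C * ((D.p₁ : ℝ) ^ x * (D.t : ℝ) ^ h * (M : ℝ) ^ D.memExp
      + (D.r : ℝ) ^ x * (((D.t - D.p₁ : ℕ) : ℝ) + D.r) ^ h)) := by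
  obtain ⟨C, hC, hac⟩ := D.exists_acProg_bound hr
  set s : ℝ := ((D.t - D.p₁ : ℕ) : ℝ) with hs
  set L : ℝ := 6 * D.alg.steps.length with hL
  have hL0 : 0 ≤ L := by positivity
  have ht : (D.t : ℝ) = s + D.p₁ := by
    rw [hs, Nat.cast_sub D.p₁_le]; ring
  have hgap : (D.t₀ : ℝ) ^ 2 + 1 ≤ s := by
    rw [hs]; exact_mod_cast D.gap
  have hr0 : (0 : ℝ) ≤ D.r := by positivity
  -- Strengthened for the induction: the subtracted t₀^(2h) term pays for the linear operations,
  -- since s + r ≥ t₀² + 1.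
  have key : ∀ M, 3 ≤ M → ∀ h x d v, RunsIn M (D.bcProg h x d v)
      (C * ((D.p₁ : ℝ) ^ x * (D.t : ℝ) ^ h * (M : ℝ) ^ D.memExp) + (D.r : ℝ) ^ x *
        ((C + L) * (s + D.r) ^ h - L * ((D.t₀ : ℝ) ^ 2) ^ h)) := by
    intro M hM h
    induction h with
    | zero =>
      intro x d v
      rw [bcProg]
      refine (hac M hM x d _).mono (le_of_eq ?_)
      simp; ring
    | succ h ih =>
      intro x d v
      refine (D.bcProg_succ_runsIn hM (ih (x + 1)) (ih x) d v).mono ?_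
      have h1 : 0 ≤ (D.r : ℝ) ^ x * (L * ((D.t₀ : ℝ) ^ 2) ^ h * (s + D.r - (D.t₀ ^ 2 + 1))) :=
        mul_nonneg (by positivity) (mul_nonneg (by positivity) (by linarith))
      -- Writing t = s + p₁ makes the main term reproduce itself exactly: the block call contributes
      -- p₁ and the single calls contribute s.
      rw [← hs, ht]
      simp only [pow_succ (D.r : ℝ) x, pow_succ (D.p₁ : ℝ) x, pow_succ (_ : ℝ) h]
      linear_combination h1
  refine ⟨C + L, by positivity, fun M hM h x d v => (key M hM h x d v).mono ?_⟩
  have h1 : 0 ≤ L * ((D.p₁ : ℝ) ^ x * (D.t : ℝ) ^ h * (M : ℝ) ^ D.memExp) := by positivity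
  have h2 : 0 ≤ (D.r : ℝ) ^ x * (L * ((D.t₀ : ℝ) ^ 2) ^ h) := by positivity
  linarith

theorem exists_bcCost_bound (hr : D.r < D.p₁) :
    ∃ C κ : ℝ, 0 < C ∧ 0 < κ ∧ ∀ M q n : ℕ, 3 ≤ M → n = D.t₀ ^ q → (M : ℝ) ^ κ ≤ n →
      ∃ c : ℕ, D.bcCost M q = c ∧
        (c : ℝ) ≤ C * ((n : ℝ) ^ Real.logb D.t₀ D.t * (M : ℝ) ^ (1 - Real.logb D.r D.p₁)) := by
  obtain ⟨C, hC, hbc⟩ := D.exists_bcProg_bound hr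
  set s : ℝ := ((D.t - D.p₁ : ℕ) : ℝ) with hs
  have ht : (D.t : ℝ) = s + D.p₁ := by
    rw [hs, Nat.cast_sub D.p₁_le]; ring
  have hr' : (D.r : ℝ) < D.p₁ := by exact_mod_cast hr
  have hr0 : (0 : ℝ) < D.r := by have := D.two_le_r; positivity
  have ht₀ : (1 : ℝ) < D.t₀ := by exact_mod_cast D.two_le_t₀
  have hs0 : 0 ≤ s := by positivity
  have hsr : 0 < s + D.r := by linarith
  have ht0 : (0 : ℝ) < D.t := by linarith
  have hlog : Real.logb D.t₀ (s + D.r) < Real.logb D.t₀ D.t :=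
    Real.logb_lt_logb ht₀ hsr (by linarith)
  set δ : ℝ := Real.logb D.t₀ D.t - Real.logb D.t₀ (s + D.r) with hδ
  have hδ0 : 0 < δ := by rw [hδ]; linarith
  have he := D.memExp_neg hr
  have powlog : ∀ (q : ℕ) {y : ℝ}, 0 < y → (((D.t₀ ^ q : ℕ) : ℝ)) ^ Real.logb D.t₀ y = y ^ q := by
    intro q y hy
    push_cast
    rw [← Real.rpow_pow_comm (by linarith), Real.rpow_logb (by linarith) (by linarith) hy]
  -- This κ turns M^κ ≤ n into n^(-δ) ≤ M^`memExp`, just enough to put the second term of the BC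
  -- bound below the first; hence the factor 2.
  refine ⟨2 * C, -D.memExp / δ, by positivity, div_pos (by linarith) hδ0, ?_⟩
  rintro M q n hM rfl hn
  have hM0 : (0 : ℝ) < M := by positivity
  have hbound : (s + D.r) ^ q ≤ (D.t : ℝ) ^ q * (M : ℝ) ^ D.memExp := by
    have h1 := Real.rpow_le_rpow_of_nonpos (by positivity) hn (neg_nonpos.2 hδ0.le)
    rw [← Real.rpow_mul hM0.le, div_mul_eq_mul_div, mul_neg, neg_mul, neg_neg,
      mul_div_cancel_right₀ _ hδ0.ne'] at h1
    have hn0 : (0 : ℝ) < ((D.t₀ ^ q : ℕ) : ℝ) := by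
      push_cast; exact pow_pos (by linarith) _
    calc (s + D.r) ^ q
        = ((D.t₀ ^ q : ℕ) : ℝ) ^ Real.logb D.t₀ D.t * ((D.t₀ ^ q : ℕ) : ℝ) ^ (-δ) := by
          rw [← Real.rpow_add hn0, hδ, ← powlog q hsr]; congr 1; ring
      _ ≤ _ := by rw [powlog q ht0]; gcongr
  have hrun := (hbc M hM q 0 1 fun s z i j => (0, s, 0, z, i, j))
  obtain ⟨c, hc, hle⟩ := hrun.ioComplexity_eq (Decomposition.outputs (D.t₀ ^ q))
  refine ⟨c, hc, hle.trans ?_⟩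
  rw [powlog q ht0]
  simp only [pow_zero, one_mul]
  change _ ≤ 2 * C * ((D.t : ℝ) ^ q * (M : ℝ) ^ D.memExp)
  have := mul_le_mul_of_nonneg_left hbound hC.le
  linarith

end Decomposition

/-! ### A straight-line program for arbitrary encodings and decodings -/

namespace Scheme

variable {K : Type*} [CommRing K] {I : Side → Type} {ι : Type} {ar : ι → Side → ℕ}

/-- Add a linear combination of the registers `u a` to the register `d`. -/
def accumulate {w : Side → ℕ} (s : Side) (d : Reg I w s) {α : Type*} (l : List α) (c : α → K)
    (u : α → Reg I w s) : List (Step K I w ι) :=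
  l.map fun a => .lin s 1 (c a) d d (u a)

/-- Set the register `d` to a linear combination of the interface registers. -/
def assign {w : Side → ℕ} (s : Side) (d : Reg I w s) (l : List (I s)) (c : I s → K) :
    List (Step K I w ι) :=
  .lin s 0 0 d d d :: accumulate s d l c .inl

/-! ### Semantics of program fragments -/

section RunWith

variable [∀ s, DecidableEq (I s)]

/-- The effect of one step, for calls that operate on the registers `arg`. -/
noncomputable def stepWith {w : Side → ℕ} (arg : (i : ι) → (s : Side) → Fin (ar i s) → Reg I w s)
    (z : (i : ι) → Fin (ar i .C) → K) (σ : (s : Side) → Reg I w s → K) :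
    Step K I w ι → (s : Side) → Reg I w s → K
  | .lin s c₁ c₂ dst u v =>
      Function.update σ s (Function.update (σ s) dst (c₁ * σ s u + c₂ * σ s v))
  | .call i => Function.update σ .C (Function.extend (arg i .C) (z i) (σ .C))

/-- The effect of a list of steps, for calls that operate on the registers `arg`. -/
noncomputable def runWith {w : Side → ℕ} (arg : (i : ι) → (s : Side) → Fin (ar i s) → Reg I w s)
    (z : (i : ι) → Fin (ar i .C) → K) (l : List (Step K I w ι)) (σ : (s : Side) → Reg I w s → K) :
    (s : Side) → Reg I w s → K :=
  l.foldl (stepWith arg z) σ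

/-- `runWith` takes the call arguments as a parameter, so fragments can be analysed before they are
bundled into a scheme. -/
theorem run_eq_runWith (P : Scheme K I ι ar) (z : (i : ι) → Fin (ar i .C) → K)
    (l : List (Step K I P.w ι)) (σ : (s : Side) → Reg I P.w s → K) :
    P.run z l σ = runWith P.arg z l σ := by
  have : P.applyStep z = stepWith P.arg z := by
    funext σ st
    cases st <;> rfl
  rw [run, runWith, this]

variable {w : Side → ℕ} (arg : (i : ι) → (s : Side) → Fin (ar i s) → Reg I w s)
  (z : (i : ι) → Fin (ar i .C) → K)

theorem runWith_nil (σ : (s : Side) → Reg I w s → K) : runWith arg z [] σ = σ := rfl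

theorem runWith_cons (st : Step K I w ι) (l : List (Step K I w ι))
    (σ : (s : Side) → Reg I w s → K) :
    runWith arg z (st :: l) σ = runWith arg z l (stepWith arg z σ st) := rfl

theorem runWith_append (l₁ l₂ : List (Step K I w ι)) (σ : (s : Side) → Reg I w s → K) :
    runWith arg z (l₁ ++ l₂) σ = runWith arg z l₂ (runWith arg z l₁ σ) := List.foldl_append

theorem run_accumulate (s : Side)
    (d : Reg I w s) {α : Type*} (l : List α) (c : α → K) (u : α → Reg I w s)
    (hu : ∀ a, u a ≠ d) (σ : (s : Side) → Reg I w s → K) :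
    runWith arg z (accumulate s d l c u) σ = Function.update σ s
      (Function.update (σ s) d (σ s d + (l.map fun a => c a * σ s (u a)).sum)) := by
  induction l generalizing σ with
  | nil => simp [accumulate, runWith_nil]
  | cons a l ih =>
    have h : accumulate s d (a :: l) c u
        = (.lin s 1 (c a) d d (u a) : Step K I w ι) :: accumulate s d l c u := rfl
    rw [h, runWith_cons, ih]
    simp [stepWith, Function.update_of_ne (hu _), add_assoc]

/-- The initial step with coefficients 0, 0 erases the unknown old contents, so the result is
independent of them. -/
theorem run_assign (s : Side) (d : Reg I w s) (hd : ∀ e, .inl e ≠ d) (l : List (I s)) (c : I s → K)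
    (σ : (s : Side) → Reg I w s → K) :
    runWith arg z (assign s d l c) σ = Function.update σ s
      (Function.update (σ s) d (l.map fun e => c e * σ s (.inl e)).sum) := by
  rw [assign, runWith_cons, run_accumulate _ _ _ _ _ _ _ hd]
  simp [stepWith, Function.update_of_ne (hd _)]

end RunWith

variable [Fintype ι]

/-- A number of work registers that suffices for the arguments of each single call. -/
def maxArity (ar : ι → Side → ℕ) (s : Side) : ℕ := Finset.univ.sup fun i => ar i s

/-- The work registers that hold the arguments of the `i`-th call. -/
def argReg (I : Side → Type) (ar : ι → Side → ℕ) (i : ι) (s : Side) (k : Fin (ar i s)) :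
    Reg I (maxArity ar) s :=
  .inr (k.castLE (Finset.le_sup (f := fun i => ar i s) (Finset.mem_univ i)))

theorem argReg_injective (i : ι) (s : Side) : Function.Injective (argReg I ar i s) :=
  Sum.inr_injective.comp (Fin.castLE_injective _)

/-- Set the output registers in `l` to zero. -/
def clearOutput (ar : ι → Side → ℕ) (l : List (I .C)) : List (Step K I (maxArity ar) ι) :=
  l.map fun e => .lin .C 0 0 (.inl e) (.inl e) (.inl e)

/-- Add the contribution of the `i`-th call to the output registers in `l`. -/
noncomputable def decode (ar : ι → Side → ℕ) (i : ι) (dec : I .C → Fin (ar i .C) → K)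
    (l : List (I .C)) : List (Step K I (maxArity ar) ι) :=
  l.flatMap fun e => accumulate .C (.inl e) Finset.univ.toList (dec e) (argReg I ar i .C)

theorem call_mem_clearOutput (i : ι) (l : List (I .C)) :
    (.call i : Step K I (maxArity ar) ι) ∉ clearOutput ar l := by
  simp [clearOutput]

theorem call_mem_decode (i j : ι) (dec : I .C → Fin (ar j .C) → K) (l : List (I .C)) :
    .call i ∉ decode ar j dec l := by
  simp [decode, accumulate]

section Run

variable [∀ s, DecidableEq (I s)] (z : (i : ι) → Fin (ar i .C) → K)
  (σ : (s : Side) → Reg I (maxArity ar) s → K)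

/-- Work registers are only read here, so every output receives its contribution from the same call
result; `hl` prevents adding it twice. -/
theorem run_decode (i : ι) (d : I .C → Fin (ar i .C) → K) (l : List (I .C)) (hl : l.Nodup) :
    (∀ s' ≠ .C, runWith (argReg I ar) z (decode ar i d l) σ s' = σ s') ∧
    (∀ k, runWith (argReg I ar) z (decode ar i d l) σ .C (.inr k) = σ .C (.inr k)) ∧
    ∀ e, runWith (argReg I ar) z (decode ar i d l) σ .C (.inl e)
      = σ .C (.inl e) + if e ∈ l then ∑ k, d e k * σ .C (argReg I ar i .C k) else 0 := by
  induction l using List.reverseRecOn with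
  | nil => simp [decode, runWith_nil]
  | append_singleton l e₀ ih =>
    obtain ⟨h₁, h₂, h₃⟩ := ih (List.Nodup.of_append_left hl)
    have he₀ : e₀ ∉ l := by
      rw [List.nodup_append] at hl
      exact fun h => hl.2.2 _ h _ (by simp) rfl
    have e : decode ar i d (l ++ [e₀]) = decode ar i d l
        ++ accumulate .C (.inl e₀) Finset.univ.toList (d e₀) (argReg I ar i .C) := by
      simp [decode]
    have hrun := run_accumulate (argReg I ar) z .C (.inl e₀)
      Finset.univ.toList (d e₀) (argReg I ar i .C) (fun _ => by simp [argReg])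
      (runWith (argReg I ar) z (decode ar i d l) σ)
    rw [e]
    rw [runWith_append, hrun]
    refine ⟨fun s' hs' => ?_, fun k => ?_, fun e => ?_⟩
    · rw [Function.update_of_ne hs', h₁ s' hs']
    · rw [Function.update_self, Function.update_of_ne (by simp), h₂]
    · rw [Function.update_self]
      by_cases he : e = e₀
      · subst he
        rw [Function.update_self, h₃, Finset.sum_map_toList]
        have hk (k) : runWith (argReg I ar) z (decode ar i d l) σ .C (argReg I ar i .C k)
          = σ .C (argReg I ar i .C k) := h₂ _
        simp [hk, he₀]
      · rw [Function.update_of_ne (by simpa using he), h₃]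
        simp [he]

theorem run_clearOutput (l : List (I .C)) :
    (∀ s' ≠ .C, runWith (argReg I ar) z (clearOutput ar l) σ s' = σ s') ∧
    ∀ e ∈ l, runWith (argReg I ar) z (clearOutput ar l) σ .C (.inl e) = 0 := by
  induction l using List.reverseRecOn with
  | nil => simp [clearOutput, runWith_nil]
  | append_singleton l e₀ ih =>
    obtain ⟨h₁, h₂⟩ := ih
    have e : (clearOutput ar (l ++ [e₀]) : List (Step K I (maxArity ar) ι))
      = clearOutput ar l ++ [.lin .C 0 0 (.inl e₀) (.inl e₀) (.inl e₀)] := by simp [clearOutput]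
    rw [e]
    rw [runWith_append, runWith_cons]
    simp only [stepWith]
    refine ⟨fun s' hs' => ?_, fun e he => ?_⟩
    · rw [← h₁ s' hs']
      exact Function.update_of_ne hs' _ _
    · rw [runWith_nil, Function.update_self]
      by_cases h : e = e₀
      · subst h; simp
      · rw [Function.update_of_ne (by simpa using h)]
        exact h₂ e (by simpa [h] using he)

end Run

/-! ### Assembling encodings, calls and decodings into one program -/

variable [∀ s, Fintype (I s)]

/-- Compute the arguments of the `i`-th call on side `s`. -/
noncomputable def encode (i : ι) (s : Side) (enc : Matrix (Fin (ar i s)) (I s) K)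
    (l : List (Fin (ar i s))) : List (Step K I (maxArity ar) ι) :=
  l.flatMap fun k => assign s (argReg I ar i s k) Finset.univ.toList (enc k)

variable (encA : (i : ι) → Matrix (Fin (ar i .A)) (I .A) K)
  (encB : (i : ι) → Matrix (Fin (ar i .B)) (I .B) K)
  (dec : (i : ι) → I .C → Fin (ar i .C) → K)

/-- Compute the arguments of the `i`-th call. -/
noncomputable def encodeCall (i : ι) : List (Step K I (maxArity ar) ι) :=
  encode i .A (encA i) Finset.univ.toList ++ encode i .B (encB i) Finset.univ.toList

/-- Compute the arguments of the `i`-th call, call, and process the result. -/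
noncomputable def processCall (i : ι) : List (Step K I (maxArity ar) ι) :=
  encodeCall encA encB i ++ .call i :: decode ar i (dec i) Finset.univ.toList

/-- Process the calls one after the other, and sum up their contributions to the output. -/
noncomputable def sequentialSteps : List (Step K I (maxArity ar) ι) :=
  clearOutput ar Finset.univ.toList ++ Finset.univ.toList.flatMap (processCall encA encB dec)

/-- The straight-line program that processes the calls one after the other, with the sum of the
contributions of the calls as its output. -/
noncomputable def sequential : Scheme K I ι ar where
  w := maxArity ar
  arg := argReg I ar
  steps := sequentialSteps encA encB dec
  arg_injective i := argReg_injective i .C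
  readonly s c₁ c₂ dst u v h hs := by
    simp only [sequentialSteps, List.mem_append, List.mem_flatMap, clearOutput, processCall,
      encodeCall, encode, decode, assign, accumulate, List.mem_cons, List.mem_map] at h
    rcases h with ⟨e, -, h⟩ | ⟨i, -, (⟨k, -, h | ⟨e, -, h⟩⟩ | ⟨k, -, h | ⟨e, -, h⟩⟩) | h |
      ⟨e, -, k, -, h⟩⟩ <;>
    cases h <;> first | rfl | exact absurd rfl hs

theorem call_mem_encodeCall (i j : ι) : .call i ∉ encodeCall encA encB j := by
  simp [encodeCall, encode, assign, accumulate]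

theorem call_mem_processCall {i j : ι} (h : .call i ∈ processCall encA encB dec j) : i = j := by
  rw [processCall, List.mem_append, List.mem_cons] at h
  rcases h with h | h | h
  · exact absurd h (call_mem_encodeCall encA encB i j)
  · simpa using h
  · exact absurd h (call_mem_decode i j _ _)

variable [∀ s, DecidableEq (I s)] (z : (i : ι) → Fin (ar i .C) → K)
  (σ : (s : Side) → Reg I (maxArity ar) s → K)

theorem run_encode (i : ι) (s : Side) (enc : Matrix (Fin (ar i s)) (I s) K)
    (l : List (Fin (ar i s))) :
    (∀ s' ≠ s, runWith (argReg I ar) z (encode i s enc l) σ s' = σ s') ∧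
    (∀ e, runWith (argReg I ar) z (encode i s enc l) σ s (.inl e) = σ s (.inl e)) ∧
    ∀ k ∈ l, runWith (argReg I ar) z (encode i s enc l) σ s (argReg I ar i s k)
      = enc.mulVec (fun e => σ s (.inl e)) k := by
  induction l using List.reverseRecOn with
  | nil => simp [encode, runWith_nil]
  | append_singleton l k ih =>
    obtain ⟨h₁, h₂, h₃⟩ := ih
    have e : encode i s enc (l ++ [k]) = encode i s enc l
        ++ assign s (argReg I ar i s k) Finset.univ.toList (enc k) := by
      simp [encode]
    rw [e, runWith_append, run_assign _ _ _ _ fun _ => by simp [argReg]]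
    refine ⟨fun s' hs' => ?_, fun e => ?_, fun k' hk' => ?_⟩
    · rw [Function.update_of_ne hs', h₁ s' hs']
    · rw [Function.update_self, Function.update_of_ne (by simp [argReg]), h₂]
    · rw [Function.update_self]
      by_cases hk : k' = k
      · subst hk
        rw [Function.update_self, Finset.sum_map_toList]
        simp only [h₂]
        rfl
      · rw [Function.update_of_ne (fun h => hk (argReg_injective i s h))]
        exact h₃ k' (by simpa [hk] using hk')

theorem run_encodeCall (i : ι) :
    (∀ s e, runWith (argReg I ar) z (encodeCall encA encB i) σ s (.inl e)
      = σ s (.inl e)) ∧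
    (∀ k, runWith (argReg I ar) z (encodeCall encA encB i) σ .A (argReg I ar i .A k)
      = (encA i).mulVec (fun e => σ .A (.inl e)) k) ∧
    ∀ k, runWith (argReg I ar) z (encodeCall encA encB i) σ .B (argReg I ar i .B k)
      = (encB i).mulVec (fun e => σ .B (.inl e)) k := by
  obtain ⟨a₁, a₂, a₃⟩ := run_encode z σ i .A (encA i) Finset.univ.toList
  obtain ⟨b₁, b₂, b₃⟩ := run_encode z
    (runWith (argReg I ar) z (encode i .A (encA i) Finset.univ.toList) σ)
    i .B (encB i) Finset.univ.toList
  rw [encodeCall]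
  rw [runWith_append]
  refine ⟨fun s e => ?_, fun k => ?_, fun k => ?_⟩
  · cases s
    · rw [b₁ _ (by simp), a₂]
    · rw [b₂, a₁ _ (by simp)]
    · rw [b₁ _ (by simp), a₁ _ (by simp)]
  · rw [b₁ _ (by simp), a₃ k (by simp)]
  · rw [b₃ k (by simp), a₁ _ (by simp)]

/-- The call writes to work registers only, so the partial sums in the output registers survive it.
-/
theorem run_processCall (i : ι) :
    (∀ s ≠ .C, ∀ e, runWith (argReg I ar) z (processCall encA encB dec i) σ s (.inl e)
      = σ s (.inl e)) ∧
    ∀ e, runWith (argReg I ar) z (processCall encA encB dec i) σ .C (.inl e)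
      = σ .C (.inl e) + ∑ k, dec i e k * z i k := by
  obtain ⟨h₁, -, -⟩ := run_encodeCall encA encB z σ i
  set τ := runWith (argReg I ar) z (encodeCall encA encB i) σ with hτ
  obtain ⟨d₁, -, d₃⟩ := run_decode z
    (stepWith (argReg I ar) z τ (.call i)) i (dec i) Finset.univ.toList
    (Finset.nodup_toList _)
  rw [processCall]
  rw [runWith_append, ← hτ, runWith_cons]
  refine ⟨fun s hs e => ?_, fun e => ?_⟩
  · rw [d₁ s hs, ← h₁ s e]
    simp only [stepWith]
    rw [Function.update_of_ne hs]
  · rw [d₃ e, ← h₁ .C e]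
    simp only [stepWith, Function.update_self, Finset.mem_toList, Finset.mem_univ, if_true]
    congr 1
    · exact Function.extend_apply' _ _ _ (by rintro ⟨k, hk⟩; exact absurd hk (by simp [argReg]))
    · refine Finset.sum_congr rfl fun k _ => ?_
      congr 1
      exact (argReg_injective i .C).extend_apply _ _ k

theorem run_processCalls (l : List ι) :
    (∀ s ≠ .C, ∀ e, runWith (argReg I ar) z (l.flatMap (processCall encA encB dec)) σ s
      (.inl e) = σ s (.inl e)) ∧
    ∀ e, runWith (argReg I ar) z (l.flatMap (processCall encA encB dec)) σ .C (.inl e)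
      = σ .C (.inl e) + (l.map fun i => ∑ k, dec i e k * z i k).sum := by
  induction l generalizing σ with
  | nil => simp [runWith_nil]
  | cons i l ih =>
    obtain ⟨h₁, h₂⟩ := run_processCall encA encB dec z σ i
    obtain ⟨i₁, i₂⟩ := ih (runWith (argReg I ar) z (processCall encA encB dec i) σ)
    rw [List.flatMap_cons]
    rw [runWith_append]
    refine ⟨fun s hs e => ?_, fun e => ?_⟩
    · rw [i₁ s hs, h₁ s hs]
    · rw [i₂, h₂, List.map_cons, List.sum_cons, add_assoc]

/-- The calls before the `i`-th may leave anything in the shared work registers, but they preserve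
the inputs, and the arguments are recomputed from these. -/
theorem exists_sequentialSteps_eq (i : ι) :
    ∃ pre post, sequentialSteps encA encB dec = pre ++ .call i :: post ∧
      .call i ∉ pre ∧ .call i ∉ post ∧ ∀ z σ,
        (∀ k, runWith (argReg I ar) z pre σ .A (argReg I ar i .A k)
          = (encA i).mulVec (fun e => σ .A (.inl e)) k) ∧
        ∀ k, runWith (argReg I ar) z pre σ .B (argReg I ar i .B k)
          = (encB i).mulVec (fun e => σ .B (.inl e)) k := by
  obtain ⟨l₁, l₂, hl⟩ := List.append_of_mem (Finset.mem_toList.2 (Finset.mem_univ i))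
  have hnd := Finset.nodup_toList (Finset.univ : Finset ι)
  rw [hl, List.nodup_append, List.nodup_cons] at hnd
  have h₁ : i ∉ l₁ := fun h => hnd.2.2 _ h _ List.mem_cons_self rfl
  have h₂ : i ∉ l₂ := hnd.2.1.1
  refine ⟨clearOutput ar Finset.univ.toList ++ (l₁.flatMap (processCall encA encB dec) ++
    encodeCall encA encB i), decode ar i (dec i) Finset.univ.toList ++
    l₂.flatMap (processCall encA encB dec), ?_, ?_, ?_, fun z σ => ?_⟩
  · rw [sequentialSteps, hl]
    simp [processCall]
  · simp only [List.mem_append, List.mem_flatMap, not_or, not_exists, not_and]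
    exact ⟨call_mem_clearOutput i _, fun j hj h => h₁ (call_mem_processCall encA encB dec h ▸ hj),
      call_mem_encodeCall encA encB i i⟩
  · simp only [List.mem_append, List.mem_flatMap, not_or, not_exists, not_and]
    exact ⟨call_mem_decode i i _ _, fun j hj h => h₂ (call_mem_processCall encA encB dec h ▸ hj)⟩
  · obtain ⟨a₁, -⟩ := run_clearOutput z σ Finset.univ.toList
    set σ₁ := runWith (argReg I ar) z (clearOutput ar Finset.univ.toList) σ with hσ₁
    obtain ⟨b₁, -⟩ := run_processCalls encA encB dec z σ₁ l₁
    set σ₂ := runWith (argReg I ar) z (l₁.flatMap (processCall encA encB dec)) σ₁ with hσ₂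
    obtain ⟨-, c₂, c₃⟩ := run_encodeCall encA encB z σ₂ i
    rw [runWith_append, ← hσ₁, runWith_append, ← hσ₂]
    refine ⟨fun k => (c₂ k).trans ?_, fun k => (c₃ k).trans ?_⟩
    · simp only [b₁ .A (by simp), a₁ .A (by simp)]
    · simp only [b₁ .B (by simp), a₁ .B (by simp)]

theorem run_sequentialSteps (e : I .C) :
    runWith (argReg I ar) z (sequentialSteps encA encB dec) σ .C (.inl e)
      = ∑ i, ∑ k, dec i e k * z i k := by
  obtain ⟨-, a₂⟩ := run_clearOutput z σ Finset.univ.toList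
  obtain ⟨-, b₂⟩ := run_processCalls encA encB dec z
    (runWith (argReg I ar) z (clearOutput ar Finset.univ.toList) σ) Finset.univ.toList
  rw [sequentialSteps, runWith_append, b₂, a₂ e (by simp), Finset.sum_map_toList, zero_add]

theorem sequential_computes : (sequential encA encB dec).Computes encA encB
    fun z e => ∑ i, ∑ k, dec i e k * z i k := by
  refine ⟨fun i => ?_, fun z σ e => ?_⟩
  · obtain ⟨pre, post, h₁, h₂, h₃, h₄⟩ := exists_sequentialSteps_eq encA encB dec i
    refine ⟨pre, post, h₁, h₂, h₃, fun z σ => ?_⟩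
    have h := run_eq_runWith (sequential encA encB dec) z pre σ
    exact ⟨fun k => (congrFun (congrFun h .A) _).trans ((h₄ z σ).1 k),
      fun k => (congrFun (congrFun h .B) _).trans ((h₄ z σ).2 k)⟩
  · rw [run_eq_runWith]
    exact run_sequentialSteps encA encB dec z σ e

end Scheme

/-! ### A decomposed algorithm for `4 × 4` matrices -/

namespace BlockStrassen

variable {K : Type*} [CommRing K]

/-- The encoding of the left factor in Strassen's algorithm. -/
def encLeft (K : Type*) [CommRing K] : Fin 7 → Matrix (Fin 2) (Fin 2) K :=
  ![!![1, 0; 0, 1], !![0, 0; 1, 1], !![1, 0; 0, 0], !![0, 0; 0, 1], !![1, 1; 0, 0],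
    !![-1, 0; 1, 0], !![0, 1; 0, -1]]

/-- The encoding of the right factor in Strassen's algorithm. -/
def encRight (K : Type*) [CommRing K] : Fin 7 → Matrix (Fin 2) (Fin 2) K :=
  ![!![1, 0; 0, 1], !![1, 0; 0, 0], !![0, 1; 0, -1], !![-1, 0; 1, 0], !![0, 0; 0, 1],
    !![1, 1; 0, 0], !![0, 0; 1, 1]]

/-- The decoding in Strassen's algorithm. -/
def decProd (K : Type*) [CommRing K] : Fin 7 → Matrix (Fin 2) (Fin 2) K :=
  ![!![1, 0; 0, 1], !![0, 0; 1, -1], !![0, 1; 0, 1], !![1, 0; 1, 0], !![-1, 1; 0, 0],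
    !![0, 0; 0, 1], !![1, 0; 0, 0]]

theorem strassen (X Y : Matrix (Fin 2) (Fin 2) K) (i k : Fin 2) :
    ∑ m, decProd K m i k * ((∑ i', ∑ j', encLeft K m i' j' * X i' j')
      * ∑ j', ∑ k', encRight K m j' k' * Y j' k') = (X * Y) i k := by
  rw [Matrix.mul_apply]
  fin_cases i <;> fin_cases k <;>
    simp [Fin.sum_univ_succ, encLeft, encRight, decProd] <;> ring

/-- The index of the row `i` of block `I`. -/
def idx : Fin 2 × Fin 2 ≃ Fin 4 := finProdFinEquiv

/-- Enumeration of the triples of bits. -/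
def triple : Fin 8 ≃ Fin 2 × Fin 2 × Fin 2 :=
  (finProdFinEquiv (m := 2) (n := 4)).symm.trans
    ((Equiv.refl _).prodCongr (finProdFinEquiv (m := 2) (n := 2)).symm)

theorem triple_zero : triple 0 = (0, 0, 0) := by decide

/-- The block in block row `I` and block column `J`. -/
def block (a : Matrix (Fin 4) (Fin 4) K) (I J : Fin 2) : Matrix (Fin 2) (Fin 2) K :=
  fun i j => a (idx (I, i)) (idx (J, j))

theorem sum_idx {R : Type*} [AddCommMonoid R] (f : Fin 4 → R) :
    ∑ i, f i = ∑ I, ∑ i, f (idx (I, i)) := by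
  rw [← Equiv.sum_comp idx, Fintype.sum_prod_type]

theorem block_mul (a b : Matrix (Fin 4) (Fin 4) K) (I L : Fin 2) :
    block (a * b) I L = ∑ J, block a I J * block b J L := by
  ext i k
  simp [block, Matrix.mul_apply, sum_idx, Matrix.sum_apply]

/-- Coefficients that are supported on block `(I, J)`, and there given by `c`. -/
def blockCoeff (c : Matrix (Fin 2) (Fin 2) K) (I J : Fin 2) (e : Fin 4 × Fin 4) : K :=
  if (idx.symm e.1).1 = I ∧ (idx.symm e.2).1 = J then c (idx.symm e.1).2 (idx.symm e.2).2 else 0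

theorem sum_blockCoeff (c : Matrix (Fin 2) (Fin 2) K) (I J : Fin 2)
    (a : Matrix (Fin 4) (Fin 4) K) :
    ∑ e, blockCoeff c I J e * a e.1 e.2 = ∑ i, ∑ j, c i j * block a I J i j := by
  rw [Fintype.sum_prod_type, sum_idx, Finset.sum_eq_single I]
  · refine Finset.sum_congr rfl fun i _ => ?_
    rw [sum_idx, Finset.sum_eq_single J]
    · simp [blockCoeff, block]
    · intro b _ hb; simp [blockCoeff, hb]
    · simp
  · intro b _ hb
    simp [blockCoeff, hb]
  · simp

/-- Selection of the entries of block `(0, 0)`. -/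
def corner (K : Type*) [CommRing K] : Matrix (Fin 4) (Fin 4 × Fin 4) K :=
  Matrix.of fun c => blockCoeff (Matrix.single (idx.symm c).1 (idx.symm c).2 1) 0 0

theorem corner_mulVec (a : Matrix (Fin 4) (Fin 4) K) (c : Fin 4) :
    (corner K).mulVec (fun e => a e.1 e.2) c = block a 0 0 (idx.symm c).1 (idx.symm c).2 := by
  refine (sum_blockCoeff (Matrix.single (idx.symm c).1 (idx.symm c).2 1) 0 0 a).trans ?_
  simp [Matrix.single_apply, Finset.sum_ite_eq, ite_and]

/-- Selection of the pair of indices `f`, for each triple of indices. -/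
def pick (K : Type*) [CommRing K] (f : Fin 2 × Fin 2 × Fin 2 → Fin 2 × Fin 2) :
    Matrix (Fin 8) (Fin 4) K :=
  Matrix.of fun m c => if c = idx (f (triple m)) then 1 else 0

theorem pick_mulVec (f : Fin 2 × Fin 2 × Fin 2 → Fin 2 × Fin 2) (x : Fin 4 → K) (m : Fin 8) :
    (pick K f).mulVec x m = x (idx (f (triple m))) := by
  simp [pick, Matrix.mulVec, dotProduct]

/-- The encoding of the seven block products other than `(0, 0, 0)`. -/
def strassenRows (c : Fin 7 → Matrix (Fin 2) (Fin 2) K)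
    (f : Fin 2 × Fin 2 × Fin 2 → Fin 2 × Fin 2) : Matrix (Fin 49) (Fin 4 × Fin 4) K :=
  Matrix.of fun k => let bm := (finProdFinEquiv (m := 7) (n := 7)).symm k
    blockCoeff (c bm.2) (f (triple bm.1.succ)).1 (f (triple bm.1.succ)).2

/-- The block of the left factor in a product of blocks. -/
def leftPair (t : Fin 2 × Fin 2 × Fin 2) : Fin 2 × Fin 2 := (t.1, t.2.1)

/-- The block of the right factor in a product of blocks. -/
def rightPair (t : Fin 2 × Fin 2 × Fin 2) : Fin 2 × Fin 2 := (t.2.1, t.2.2)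

/-- The block of the product to which a product of blocks contributes. -/
def prodPair (t : Fin 2 × Fin 2 × Fin 2) : Fin 2 × Fin 2 := (t.1, t.2.2)

/-- The final decoding. -/
def outer (K : Type*) [CommRing K] : Matrix (Fin 4 × Fin 4) (Fin 4 ⊕ Fin 49) K :=
  Matrix.of fun e => Sum.elim (fun c => corner K c e)
    (fun k => strassenRows (decProd K) prodPair k e)

theorem blockCoeff_idx (c : Matrix (Fin 2) (Fin 2) K) (I J I' J' i j : Fin 2) :
    blockCoeff c I J (idx (I', i), idx (J', j)) = if I' = I ∧ J' = J then c i j else 0 := by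
  simp [blockCoeff]

/-- Blockwise, the product is a sum over eight index triples. The triple (0,0,0) is the classical
block call, and each of the other seven is one copy of Strassen's identity. -/
theorem outer_mulVec (a b : Matrix (Fin 4) (Fin 4) K) (e : Fin 4 × Fin 4) :
    (outer K).mulVec (Sum.elim ((pick K prodPair).transpose.mulVec
        ((pick K leftPair).mulVec ((corner K).mulVec fun e => a e.1 e.2)
          * (pick K rightPair).mulVec ((corner K).mulVec fun e => b e.1 e.2)))
      ((strassenRows (encLeft K) leftPair).mulVec (fun e => a e.1 e.2)
        * (strassenRows (encRight K) rightPair).mulVec fun e => b e.1 e.2)) e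
      = (a * b) e.1 e.2 := by
  obtain ⟨i, k⟩ := e
  obtain ⟨⟨I, i⟩, rfl⟩ := idx.surjective i
  obtain ⟨⟨L, k⟩, rfl⟩ := idx.surjective k
  change _ = block (a * b) I L i k
  -- The contribution of one block product to the fixed entry; the condition says that it lands in
  -- the block of that entry.
  let F : Fin 2 × Fin 2 × Fin 2 → K := fun t =>
    if I = t.1 ∧ L = t.2.2 then (block a t.1 t.2.1 * block b t.2.1 t.2.2) i k else 0
  have hsum : F (triple 0) + ∑ m : Fin 7, F (triple m.succ) = block (a * b) I L i k := by
    rw [← Fin.sum_univ_succ (fun m => F (triple m)), Equiv.sum_comp triple F, block_mul,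
      Matrix.sum_apply, Fintype.sum_prod_type, Finset.sum_eq_single I]
    · rw [Fintype.sum_prod_type]
      simp [F]
    · intro b _ hb
      simp [F, Ne.symm hb]
    · simp
  rw [← hsum]
  simp only [Matrix.mulVec, dotProduct, Fintype.sum_sum_type, Sum.elim_inl, Sum.elim_inr, outer,
    Matrix.of_apply]
  congr 1
  · rw [triple_zero, sum_idx]
    simp only [corner, Matrix.of_apply, blockCoeff_idx, Equiv.symm_apply_apply, F]
    by_cases h : I = 0 ∧ L = 0
    · have e1 (x : Fin 4 → K) (p : Fin 2 × Fin 2 × Fin 2 → Fin 2 × Fin 2) (m : Fin 8) :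
        ∑ c, pick K p m c * x c = x (idx (p (triple m))) := pick_mulVec p x m
      have e2 (a : Matrix (Fin 4) (Fin 4) K) (c : Fin 4) : ∑ e,
        blockCoeff (Matrix.single (idx.symm c).1 (idx.symm c).2 1) 0 0 e * a e.1 e.2
          = block a 0 0 (idx.symm c).1 (idx.symm c).2 := corner_mulVec a c
      simp only [if_pos h, Pi.mul_apply, Matrix.mulVec, dotProduct, Matrix.of_apply, e1, e2,
        Matrix.transpose_apply, Equiv.symm_apply_apply]
      -- Of the four results of the block call, only the one at position (i, k) is copied to this
      -- entry.
      rw [Finset.sum_eq_single i, Finset.sum_eq_single k]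
      · simp only [Matrix.single_apply_same, one_mul]
        -- Summing over triples instead of `Fin 8`, the selectors leave the classical sum over the
        -- middle index.
        rw [← Equiv.sum_comp triple.symm]
        simp only [pick, Matrix.of_apply, Equiv.apply_symm_apply, Fintype.sum_prod_type, prodPair,
          leftPair, rightPair, Equiv.apply_eq_iff_eq, Prod.mk.injEq, Matrix.mul_apply]
        rw [Finset.sum_eq_single i]
        · simp
        · intro b _ hb; simp [Ne.symm hb]
        · simp
      · intro b _ hb; simp [hb]
      · simp
      · intro b _ hb; simp [hb]
      · simp
    · simp [if_neg h]
  · rw [← Equiv.sum_comp (finProdFinEquiv (m := 7) (n := 7)), Fintype.sum_prod_type]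
    refine Finset.sum_congr rfl fun m _ => ?_
    have e1 (c : Fin 7 → Matrix (Fin 2) (Fin 2) K) (p : Fin 2 × Fin 2 × Fin 2 → Fin 2 × Fin 2)
        (a : Matrix (Fin 4) (Fin 4) K) (m n : Fin 7) :
        (strassenRows c p).mulVec (fun e => a e.1 e.2) (finProdFinEquiv (m := 7) (n := 7) (m, n))
          = ∑ i, ∑ j, c n i j
            * block a (p (triple m.succ)).1 (p (triple m.succ)).2 i j := by
      rw [← sum_blockCoeff]
      simp only [Matrix.mulVec, dotProduct, strassenRows, Matrix.of_apply]
      simp only [Equiv.symm_apply_apply]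
    simp only [Pi.mul_apply, e1]
    have e2 (n : Fin 7) : strassenRows (decProd K) prodPair
        (finProdFinEquiv (m := 7) (n := 7) (m, n)) (idx (I, i), idx (L, k))
        = if I = (triple m.succ).1 ∧ L = (triple m.succ).2.2 then decProd K n i k else 0 := by
      rw [← blockCoeff_idx]
      simp only [strassenRows, Matrix.of_apply, Equiv.symm_apply_apply, prodPair]
    simp only [e2, F, leftPair, rightPair]
    by_cases h : I = (triple m.succ).1 ∧ L = (triple m.succ).2.2
    · simp only [if_pos h]
      exact strassen _ _ i k
    · simp [if_neg h]

/-- The rows of an encoding or decoding matrix: the eight products of the block call, and then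
the single products. -/
def encoding (c : Fin 7 → Matrix (Fin 2) (Fin 2) K)
    (f : Fin 2 × Fin 2 × Fin 2 → Fin 2 × Fin 2) : Matrix (Fin 57) (Fin 4 × Fin 4) K :=
  Matrix.of (Fin.append (m := 8) (n := 49) (pick K f * corner K) (strassenRows c f))

theorem encoding_castAdd (c : Fin 7 → Matrix (Fin 2) (Fin 2) K)
    (f : Fin 2 × Fin 2 × Fin 2 → Fin 2 × Fin 2) (m : Fin 8) :
    encoding c f (Fin.castAdd 49 m) = (pick K f * corner K) m := Fin.append_left _ _ m

theorem encoding_natAdd (c : Fin 7 → Matrix (Fin 2) (Fin 2) K)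
    (f : Fin 2 × Fin 2 × Fin 2 → Fin 2 × Fin 2) (k : Fin 49) :
    encoding c f (Fin.natAdd 8 k) = strassenRows c f k := Fin.append_right _ _ k

/-- The first eight decoding rows factor as `pick * corner`. Transposing splits the decoding into
`pick` transposed, done inside the block call, and `corner` transposed, which belongs to `outer`. -/
theorem encoding_transpose_mulVec (z : Fin 57 → K) :
    (encoding (decProd K) prodPair).transpose.mulVec z
    = (outer K).mulVec (Sum.elim ((pick K prodPair).transpose.mulVec (z ∘ Fin.castAdd 49))
      (z ∘ Fin.natAdd 8)) := by
  ext e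
  simp only [Matrix.mulVec, dotProduct, Matrix.transpose_apply, Fintype.sum_sum_type, Sum.elim_inl,
    Sum.elim_inr, Function.comp_apply]
  rw [Fin.sum_univ_add (a := 8) (b := 49)]
  simp only [encoding_castAdd, encoding_natAdd, outer, Matrix.of_apply, Matrix.mul_apply,
    Finset.sum_mul, Finset.mul_sum, Sum.elim_inl, Sum.elim_inr]
  rw [Finset.sum_comm]
  congr 1
  exact Finset.sum_congr rfl fun c _ => Finset.sum_congr rfl fun m _ => by ring

theorem encoding_isMatMul (a b : Matrix (Fin 4) (Fin 4) K) (e : Fin 4 × Fin 4) :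
    (encoding (decProd K) prodPair).transpose.mulVec
        ((encoding (encLeft K) leftPair).mulVec (fun e => a e.1 e.2)
      * (encoding (encRight K) rightPair).mulVec fun e => b e.1 e.2) e = (a * b) e.1 e.2 := by
  rw [← outer_mulVec a b e, encoding_transpose_mulVec]
  have h₁ (c : Fin 7 → Matrix (Fin 2) (Fin 2) K) (f : Fin 2 × Fin 2 × Fin 2 → Fin 2 × Fin 2)
      (x : Fin 4 × Fin 4 → K) : (encoding c f).mulVec x ∘ Fin.castAdd 49
        = (pick K f).mulVec ((corner K).mulVec x) := by
    rw [Matrix.mulVec_mulVec]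
    ext m
    exact congrArg (· ⬝ᵥ x) (encoding_castAdd c f m)
  have h₂ (c : Fin 7 → Matrix (Fin 2) (Fin 2) K) (f : Fin 2 × Fin 2 × Fin 2 → Fin 2 × Fin 2)
      (x : Fin 4 × Fin 4 → K) : (encoding c f).mulVec x ∘ Fin.natAdd 8
        = (strassenRows c f).mulVec x := by
    ext k
    exact congrArg (· ⬝ᵥ x) (encoding_natAdd c f k)
  rw [← h₁ (encLeft K), ← h₁ (encRight K), ← h₂, ← h₂]
  rfl

/-- The lengths of the block call. -/
def blockLength (_ : Side) : ℕ := 4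

/-- The contribution of each call to the output. -/
def contribution (K : Type*) [CommRing K] :
    (i : Option (Fin 49)) → Fin 4 × Fin 4 → Fin (callArity blockLength i .C) → K
  | none => fun e c => outer K e (.inl c)
  | some k => fun e _ => outer K e (.inr k)

theorem outer_mulVec_eq_sum (z : (i : Option (Fin 49)) → Fin (callArity blockLength i .C) → K)
    (e : Fin 4 × Fin 4) :
    (outer K).mulVec (Sum.elim (z none) fun k => z (some k) (0 : Fin 1)) e
      = ∑ i, ∑ k, contribution K i e k * z i k := by
  have h (k : Fin 49) : ∑ l, contribution K (some k) e l * z (some k) l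
      = outer K e (.inr k) * z (some k) (0 : Fin 1) := Fin.sum_univ_one _
  simp only [Fintype.sum_option, h, Matrix.mulVec, dotProduct, Fintype.sum_sum_type]
  rfl

/-- The encoding matrix of each call. -/
def callEncoding (c : Fin 7 → Matrix (Fin 2) (Fin 2) K)
    (f : Fin 2 × Fin 2 × Fin 2 → Fin 2 × Fin 2) (s : Side) :
    (i : Option (Fin 49)) → Matrix (Fin (callArity blockLength i s)) (Fin 4 × Fin 4) K
  | none => corner K
  | some k => Matrix.of fun _ => encoding c f (Fin.natAdd 8 k)

/-- The `⟨4,4,4;57⟩`-algorithm that multiplies `2 × 2` blocks by Strassen's algorithm, except for one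
of the eight products of blocks, which is computed by the eight products of the standard algorithm
and is the block call of the decomposition. -/
noncomputable def decomposition (K : Type*) [CommRing K] : Decomposition K where
  t₀ := 4
  t := 57
  p₁ := 8
  p := blockLength
  two_le_t₀ := by norm_num
  p₁_le := by norm_num
  two_le_p _ := by norm_num [blockLength]
  gap := by norm_num
  U := encoding (encLeft K) leftPair
  V := encoding (encRight K) rightPair
  W := encoding (decProd K) prodPair
  isMatMul a b i j := encoding_isMatMul a b (i, j)
  sel₁ := Fin.castAddOrderEmb 49
  sel := Fin.natAdd 8
  psi₁₁ := corner K
  psi₁₂ := pick K leftPair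
  psi_eq := by
    ext m e
    exact congrFun (encoding_castAdd _ _ m) e
  phi₁₁ := corner K
  phi₁₂ := pick K rightPair
  phi_eq := by
    ext m e
    exact congrFun (encoding_castAdd _ _ m) e
  dec₁ := (pick K prodPair).transpose
  dec₀ := outer K
  dec_eq := encoding_transpose_mulVec
  ac := Scheme.sequential (fun i => Matrix.of fun _ => pick K leftPair i)
    (fun i => Matrix.of fun _ => pick K rightPair i) (fun i e _ => pick K prodPair i e)
  ac_computes := by
    have h : (fun (z : Fin 8 → Fin 1 → K) => (pick K prodPair).transpose.mulVec fun i => z i 0)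
        = fun z e => ∑ i, ∑ k, pick K prodPair i e * z i k := by
      funext z e
      simp [Matrix.mulVec, dotProduct]
    exact (congrArg (Scheme.Computes _ _ _) h).mpr (Scheme.sequential_computes _ _ _)
  alg := Scheme.sequential (callEncoding (encLeft K) leftPair .A)
    (callEncoding (encRight K) rightPair .B) (contribution K)
  alg_computes := by
    convert Scheme.sequential_computes (I := fun _ => Fin 4 × Fin 4)
      (ar := callArity blockLength) (callEncoding (encLeft K) leftPair .A)
      (callEncoding (encRight K) rightPair .B) (contribution K) using 1
    · funext i
      cases i <;> rfl
    · funext i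
      cases i <;> rfl
    · funext z e
      exact outer_mulVec_eq_sum z e

/-- Since r = t₀ = 4, both logarithms have the same base, and the claim is 57 < 8². -/
theorem exponent_lt : 1 - Real.logb 4 8 < 1 - Real.logb 4 57 / 2 := by
  have h : Real.logb 4 57 < 2 * Real.logb 4 8 := by
    calc Real.logb 4 57 < Real.logb 4 (8 ^ 2) :=
          Real.logb_lt_logb (by norm_num) (by norm_num) (by norm_num)
      _ = 2 * Real.logb 4 8 := by rw [Real.logb_pow]; norm_num
  linarith

end BlockStrassen

theorem mainTheorem8 {K : Type*} [CommRing K] :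
    (∀ D : Decomposition K, D.r < D.p₁ →
      ∃ C κ : ℝ, 0 < C ∧ 0 < κ ∧ ∀ M q n : ℕ, 3 ≤ M → n = D.t₀ ^ q → (M : ℝ) ^ κ ≤ n →
        ∃ c : ℕ, D.bcCost M q = c ∧
          (c : ℝ) ≤ C * ((n : ℝ) ^ Real.logb D.t₀ D.t * (M : ℝ) ^ (1 - Real.logb D.r D.p₁))) ∧
    (∃ D : Decomposition K, D.r < D.p₁ ∧
      1 - Real.logb D.r D.p₁ < 1 - Real.logb D.t₀ D.t / 2) := by
  refine ⟨fun D hr => D.exists_bcCost_bound hr, BlockStrassen.decomposition K, ?_, ?_⟩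
  · simp [Decomposition.r, BlockStrassen.decomposition, BlockStrassen.blockLength]
  · simpa [Decomposition.r, BlockStrassen.decomposition, BlockStrassen.blockLength]
      using BlockStrassen.exponent_lt
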